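/- **Setting.** Let $1\le k<d$, let $A\in\mathbb R^{d\times d}$ be symmetric and $B\in\mathbb R^{d\times d}$ symmetric positive definite. Write $\|u\|_B^2=u^\top Bu$ and $\|U\|_B^2=\mathrm{tr}(U^\top BU)$. Let $v_1,\dots,v_d$ be generalized eigenvectors, $Av_i=\lambda_iBv_i$, $v_i^\top Bv_j=\delta_{ij}$, ordered so that $|\lambda_1|\ge\dots\ge|\lambda_d|$; assume $|\lambda_{k+1}|<|\lambda_k|$, and put $$V=(v_1,\dots,v_k),\qquad \rho=1-\frac{|\lambda_{k+1}|}{|\lambda_k|},\qquad \gamma=\frac{|\lambda_1|}{|\lambda_k|}.$$ For $d\times k$ matrices $W,V$ with $W^\top BW=V^\top BV=I$, the largest principal angle in the $B$-norm is $\theta(W,V)=\arccos\sigma_{\min}(V^\top BW)$. Let $\mathrm{nnz}(\cdot)$ be the number of nonzero entries and $\kappa(B)$ the ratio of the largest to the smallest eigenvalue of $B$. Time is the number of elementary steps: real additions, subtractions, multiplications, divisions and square roots, and the storing of computed entries; $A$ and $B$ are stored in sparse form. **Algorithm GenELinK.** From an initial $\tilde W_0\in\mathbb R^{d\times k}$,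 set $W_0=\mathrm{GS}_B(\tilde W_0)$, where $\mathrm{GS}_B$ is the Gram–Schmidt process for $\langle x,y\rangle_B=x^\top By$. For $t=0,\dots,T-1$: compute $\Gamma_t=(W_t^\top BW_t)^{-1}(W_t^\top AW_t)$; let $\tilde W_{t+1}$ be the output of an approximate solver for the $k$ linear systems $BW=AW_t$, started at $W_t\Gamma_t$, that reduces the error by the factor $\delta_t$; set $W_{t+1}=\mathrm{GS}_B(\tilde W_{t+1})$. Return $W_T$. **Theorem.** There is an absolute constant hidden in $O(\cdot)$ such that the following holds for every $\tilde W_0$ for which $\theta_0=\theta(W_0,V)$ satisfies $\cos\theta_0>0$, and every $0<\varepsilon<1$. Run GenELinK for $$T=\left\lceil\frac2\rho\log\frac1{\varepsilon\cos\theta_0}\right\rceil$$ iterations with $\delta_t=\frac{\rho^2\cos^4\theta_0}{64k\gamma^2}$ for $t<T_1$ and $\delta_t=\frac{\rho^2}{64k\gamma^2}$ for $t\ge T_1$, where $T_1=0$ if $\tan\theta_0\le1$ and $T_1=\lceil\frac2\rho\log\tan\theta_0\rceil$ otherwise. 1. Suppose the solver, for all $C,X_0\in\mathbb R^{d\times k}$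 and $0<\delta<1$, takes time at most $\mathcal T(\delta)$ to output $X_1$ with $\|X_1-B^{-1}C\|_B^2\le\delta\|X_0-B^{-1}C\|_B^2$. Then $W_T^\top BW_T=I$ and $\sin\theta(W_T,V)\le\varepsilon$, and the total time is $$O\left(\frac1\rho\left(\log\frac1{\cos\theta_0}\cdot\mathcal T\left(\tfrac{\rho^2\cos^4\theta_0}{64k\gamma^2}\right)+\mathcal T\left(\tfrac{\rho^2}{64k\gamma^2}\right)\log\frac2\varepsilon\right)+\frac1\rho\left(\mathrm{nnz}(A)k+\mathrm{nnz}(B)k+dk^2\right)\log\frac2{\varepsilon\cos\theta_0}\right).$$ 2. Suppose instead that the $k$ systems are solved one column at a time by a solver that, for all $b,u_0\in\mathbb R^d$ and $0<\delta<1$, takes time at most $\mathcal T(\delta)$ to output $u_1$ with $\|u_1-B^{-1}b\|_B^2\le\delta\|u_0-B^{-1}b\|_B^2$. Then the same holds with $k\,\mathcal T(\cdot)$ in place of $\mathcal T(\cdot)$ in the time bound. 3. Suppose the $k$ systems are solved one column at a time by Nesterov's accelerated gradient descent on $f(w)=\frac12w^\top Bw-w^\top b$: with $\alpha,\beta$ the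 smallest and largest eigenvalues of $B$, $Q=\beta/\alpha$ and $y_0=x_0=u_0$, iterate $y_{s+1}=x_s-\frac1\beta(Bx_s-b)$, $x_{s+1}=y_{s+1}+\frac{\sqrt Q-1}{\sqrt Q+1}(y_{s+1}-y_s)$ for $\lceil\sqrt{\kappa(B)}\log(2/\delta)\rceil$ steps and return the last $y_s$. Then $W_T^\top BW_T=I$ and $\sin\theta(W_T,V)\le\varepsilon$, and the total time is $$O\left(\frac{\mathrm{nnz}(B)k\sqrt{\kappa(B)}}{\rho}\left(\log\frac1{\cos\theta_0}\log\frac{k\gamma}{\rho\cos\theta_0}+\log\frac2\varepsilon\log\frac{2k\gamma}\rho\right)+\frac{\mathrm{nnz}(A)k+dk^2}\rho\log\frac2{\varepsilon\cos\theta_0}\right).$$ -/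

import Mathlib

open scoped Matrix

noncomputable section

namespace GenEig

/-! ## Cost model

A real-arithmetic machine with unit cost. A computation is a value together with the number of
elementary steps spent on it. Steps are charged by the primitives below only: every addition,
subtraction, multiplication, division and square root of reals costs one step, and so does storing
each entry of a computed vector or matrix. -/

/-- A computed value with the number of elementary steps used to compute it. -/
structure Timed (α : Type) where
  /-- the result -/
  val : α
  /-- the number of elementary steps -/
  time : ℕ

/-- Sequential composition adds the step counts. -/
instance : Monad Timed where
  pure a := ⟨a, 0⟩
  bind x f := ⟨(f x.val).val, x.time + (f x.val).time⟩

namespace Timed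

/-- Spend `n` steps. -/
def tick (n : ℕ) : Timed Unit := ⟨(), n⟩

/-- `x + y`, one step. -/
def add (x y : ℝ) : Timed ℝ := ⟨x + y, 1⟩

/-- `x - y`, one step. -/
def sub (x y : ℝ) : Timed ℝ := ⟨x - y, 1⟩

/-- `x * y`, one step. -/
def mul (x y : ℝ) : Timed ℝ := ⟨x * y, 1⟩

/-- `x / y`, one step. -/
def div (x y : ℝ) : Timed ℝ := ⟨x / y, 1⟩

/-- `√x`, one step. -/
def sqrt (x : ℝ) : Timed ℝ := ⟨Real.sqrt x, 1⟩

/-- Compute the terms `f i`, `i ∈ s`, and add them up: one addition for each term. -/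
def sumOver {n : ℕ} (s : Finset (Fin n)) (f : Fin n → Timed ℝ) : Timed ℝ :=
  ⟨∑ i ∈ s, (f i).val, ∑ i ∈ s, ((f i).time + 1)⟩

/-- Compute and store the entries of a vector. -/
def vec {n : ℕ} (f : Fin n → Timed ℝ) : Timed (Fin n → ℝ) :=
  ⟨fun i => (f i).val, ∑ i, ((f i).time + 1)⟩

/-- Compute and store the entries of a matrix. -/
def mat {m n : ℕ} (f : Fin m → Fin n → Timed ℝ) : Timed (Matrix (Fin m) (Fin n) ℝ) :=
  ⟨Matrix.of fun i j => (f i j).val, ∑ i, ∑ j, ((f i j).time + 1)⟩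

/-- Compute the columns of a `d × k` matrix one after the other. -/
def columns {d k : ℕ} (f : Fin k → Timed (Fin d → ℝ)) : Timed (Matrix (Fin d) (Fin k) ℝ) :=
  ⟨Matrix.of fun i j => (f j).val i, ∑ j, ((f j).time + 1)⟩

/-- `for i = 0, …, n - 1` run `body i` on the current state. -/
def loop {σ : Type} (body : ℕ → σ → Timed σ) : ℕ → σ → Timed σ
  | 0, s => pure s
  | n + 1, s => do
    let s' ← loop body n s
    body n s'

/-- `for i : Fin n`, in increasing order, run `body i` on the current state. -/
def forFin {σ : Type} {n : ℕ} (body : Fin n → σ → Timed σ) (s : σ) : Timed σ :=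
  loop (fun i s => if h : i < n then body ⟨i, h⟩ s else pure s) n s

end Timed

open Timed

/-! ## Linear algebra routines -/

/-- The number of nonzero entries of a matrix. -/
def nnz {m n : ℕ} (S : Matrix (Fin m) (Fin n) ℝ) : ℕ :=
  (Finset.univ.filter fun p : Fin m × Fin n => S p.1 p.2 ≠ 0).card

/-- The column indices of the nonzero entries in row `i`; a sparse matrix is stored row by row as
the list of these indices with the corresponding entries. -/
def rowSupport {m n : ℕ} (S : Matrix (Fin m) (Fin n) ℝ) (i : Fin m) : Finset (Fin n) :=
  Finset.univ.filter fun j => S i j ≠ 0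

/-- The inner product of two vectors. -/
def dot {n : ℕ} (x y : Fin n → ℝ) : Timed ℝ :=
  sumOver Finset.univ fun i => mul (x i) (y i)

/-- The product of a sparse matrix and a vector. -/
def sparseMulVec {m n : ℕ} (S : Matrix (Fin m) (Fin n) ℝ) (x : Fin n → ℝ) : Timed (Fin m → ℝ) :=
  vec fun i => sumOver (rowSupport S i) fun l => mul (S i l) (x l)

/-- The product of a sparse matrix and a dense matrix. -/
def sparseMul {m n k : ℕ} (S : Matrix (Fin m) (Fin n) ℝ) (X : Matrix (Fin n) (Fin k) ℝ) :
    Timed (Matrix (Fin m) (Fin k) ℝ) :=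
  mat fun i j => sumOver (rowSupport S i) fun l => mul (S i l) (X l j)

/-- The product of two dense matrices. -/
def denseMul {m n k : ℕ} (X : Matrix (Fin m) (Fin n) ℝ) (Y : Matrix (Fin n) (Fin k) ℝ) :
    Timed (Matrix (Fin m) (Fin k) ℝ) :=
  mat fun i j => sumOver Finset.univ fun l => mul (X i l) (Y l j)

/-- `G⁻¹ H` by Gauss–Jordan elimination on `[G | H]` without pivoting, for positive definite `G`. -/
def gaussJordan {k m : ℕ} (G : Matrix (Fin k) (Fin k) ℝ) (H : Matrix (Fin k) (Fin m) ℝ) :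
    Timed (Matrix (Fin k) (Fin m) ℝ) := do
  let r ← forFin (fun (p : Fin k) (s : Matrix (Fin k) (Fin k) ℝ × Matrix (Fin k) (Fin m) ℝ) => do
      let g ← vec fun j => div (s.1 p j) (s.1 p p)
      let h ← vec fun j => div (s.2 p j) (s.1 p p)
      let G' ← mat fun i j =>
        if i = p then pure (g j) else do
          let a ← mul (s.1 i p) (g j)
          sub (s.1 i j) a
      let H' ← mat fun i j =>
        if i = p then pure (h j) else do
          let a ← mul (s.1 i p) (h j)
          sub (s.2 i j) a
      pure (G', H')) (G, H)
  pure r.2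

/-- The Gram–Schmidt process on the columns of `W`, for the inner product `⟨x, y⟩_B = xᵀ B y`:
column `j` is replaced by its component `B`-orthogonal to the previous output columns, divided by
its `B`-norm. -/
def gramSchmidt {d k : ℕ} (B : Matrix (Fin d) (Fin d) ℝ) (W : Matrix (Fin d) (Fin k) ℝ) :
    Timed (Matrix (Fin d) (Fin k) ℝ) :=
  forFin (fun (j : Fin k) (Q : Matrix (Fin d) (Fin k) ℝ) => do
    let bw ← sparseMulVec B fun l => W l j
    let c ← vec fun i : Fin k => if i < j then dot (fun l => Q l i) bw else pure 0
    let u ← vec fun l => do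
      let s ← sumOver (Finset.univ.filter fun i => i < j) fun i => mul (c i) (Q l i)
      sub (W l j) s
    let bu ← sparseMulVec B u
    let n2 ← dot u bu
    let nrm ← Timed.sqrt n2
    let q ← vec fun l => div (u l) nrm
    pure (Q.updateCol j q)) 0

/-! ## Approximate linear system solvers -/

/-- The squared `B`-norm `uᵀ B u`. -/
def normSqB {d : ℕ} (B : Matrix (Fin d) (Fin d) ℝ) (u : Fin d → ℝ) : ℝ :=
  u ⬝ᵥ (B *ᵥ u)

/-- `solve δ b u₀` is an approximate solver for single systems `B u = b`: started at `u₀` it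
reduces the error `‖u - B⁻¹ b‖_B²` by the factor `δ`, in at most `τ δ` steps. -/
def IsSolver {d : ℕ} (B : Matrix (Fin d) (Fin d) ℝ)
    (solve : ℝ → (Fin d → ℝ) → (Fin d → ℝ) → Timed (Fin d → ℝ)) (τ : ℝ → ℝ) : Prop :=
  ∀ δ : ℝ, 0 < δ → δ < 1 → ∀ b u₀ : Fin d → ℝ,
    normSqB B ((solve δ b u₀).val - B⁻¹ *ᵥ b) ≤ δ * normSqB B (u₀ - B⁻¹ *ᵥ b) ∧
      ((solve δ b u₀).time : ℝ) ≤ τ δ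

/-- The squared `B`-norm of a matrix: the sum over its columns, `tr (Uᵀ B U)`. -/
def matNormSqB {d k : ℕ} (B : Matrix (Fin d) (Fin d) ℝ) (U : Matrix (Fin d) (Fin k) ℝ) : ℝ :=
  (Uᵀ * B * U).trace

/-- `solve δ C X₀` is an approximate solver for `k` simultaneous systems `B X = C`: started at `X₀`
it reduces the total error `‖X - B⁻¹ C‖_B²` by the factor `δ`, in at most `τ δ` steps. -/
def IsBlockSolver {d k : ℕ} (B : Matrix (Fin d) (Fin d) ℝ)
    (solve : ℝ → Matrix (Fin d) (Fin k) ℝ → Matrix (Fin d) (Fin k) ℝ →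
      Timed (Matrix (Fin d) (Fin k) ℝ)) (τ : ℝ → ℝ) : Prop :=
  ∀ δ : ℝ, 0 < δ → δ < 1 → ∀ C X₀ : Matrix (Fin d) (Fin k) ℝ,
    matNormSqB B ((solve δ C X₀).val - B⁻¹ * C) ≤ δ * matNormSqB B (X₀ - B⁻¹ * C) ∧
      ((solve δ C X₀).time : ℝ) ≤ τ δ

/-- Solve `k` systems independently, column by column, with a solver for single systems. -/
def columnwise {d k : ℕ} (solve : ℝ → (Fin d → ℝ) → (Fin d → ℝ) → Timed (Fin d → ℝ))
    (δ : ℝ) (C X₀ : Matrix (Fin d) (Fin k) ℝ) : Timed (Matrix (Fin d) (Fin k) ℝ) :=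
  columns fun j => solve δ (fun i => C i j) (fun i => X₀ i j)

/-! ## Nesterov's accelerated gradient descent -/

/-- The largest eigenvalue of a symmetric matrix. -/
def eigMax {d : ℕ} (B : Matrix (Fin d) (Fin d) ℝ) : ℝ := sSup (spectrum ℝ B)

/-- The smallest eigenvalue of a symmetric matrix. -/
def eigMin {d : ℕ} (B : Matrix (Fin d) (Fin d) ℝ) : ℝ := sInf (spectrum ℝ B)

/-- The condition number of a positive definite matrix. -/
def cond {d : ℕ} (B : Matrix (Fin d) (Fin d) ℝ) : ℝ := eigMax B / eigMin B

/-- `N` iterations of accelerated gradient descent from `u₀` on `f(w) = ½ wᵀ B w - wᵀ b`, which is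
`α`-strongly convex and `β`-smooth. The state is the pair `(x_t, y_t)`, with `y_0 = x_0 = u₀`, and
the gradient is `B x - b`. -/
def agd {d : ℕ} (B : Matrix (Fin d) (Fin d) ℝ) (α β : ℝ) (N : ℕ) (b u₀ : Fin d → ℝ) :
    Timed (Fin d → ℝ) := do
  let η ← div 1 β
  let Q ← div β α
  let s ← Timed.sqrt Q
  let num ← sub s 1
  let den ← add s 1
  let μ ← div num den
  let r ← loop (fun _ (st : (Fin d → ℝ) × (Fin d → ℝ)) => do
      let Bx ← sparseMulVec B st.1
      let y ← vec fun i => do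
        let g ← sub (Bx i) (b i)
        let step ← mul η g
        sub (st.1 i) step
      let x ← vec fun i => do
        let diff ← sub (y i) (st.2 i)
        let mom ← mul μ diff
        add (y i) mom
      pure (x, y)) N (u₀, u₀)
  pure r.2

/-- Accelerated gradient descent as a solver for single systems: `⌈√κ(B) log (2 / δ)⌉` iterations. -/
def agdSolver {d : ℕ} (B : Matrix (Fin d) (Fin d) ℝ) (δ : ℝ) (b u₀ : Fin d → ℝ) :
    Timed (Fin d → ℝ) :=
  agd B (eigMin B) (eigMax B) ⌈Real.sqrt (cond B) * Real.log (2 / δ)⌉₊ b u₀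

/-! ## GenELinK -/

/-- GenELinK: `T` iterations of approximate orthogonal iteration, from the initial matrix `W̃₀`.
In iteration `t`, `Γ_t = (W_tᵀ B W_t)⁻¹ (W_tᵀ A W_t)`, the block solver is called with accuracy
`δ t` and initialization `W_t Γ_t` on `B W = A W_t`, i.e. on the minimization of
`tr (½ Wᵀ B W - Wᵀ A W_t)`, and its output is `B`-orthonormalized. The first line charges for
drawing the `d k` entries of `W̃₀`. -/
def genELinK {d k : ℕ} (A B : Matrix (Fin d) (Fin d) ℝ)
    (solve : ℝ → Matrix (Fin d) (Fin k) ℝ → Matrix (Fin d) (Fin k) ℝ →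
      Timed (Matrix (Fin d) (Fin k) ℝ))
    (δ : ℕ → ℝ) (T : ℕ) (W₀tilde : Matrix (Fin d) (Fin k) ℝ) :
    Timed (Matrix (Fin d) (Fin k) ℝ) := do
  tick (d * k)
  let W₀ ← gramSchmidt B W₀tilde
  loop (fun t W => do
    let BW ← sparseMul B W
    let AW ← sparseMul A W
    let G ← denseMul Wᵀ BW
    let H ← denseMul Wᵀ AW
    let Γ ← gaussJordan G H
    let X₀ ← denseMul W Γ
    let Wtilde ← solve (δ t) AW X₀
    gramSchmidt B Wtilde) T W₀

/-! ## Generalized eigenvectors and principal angles -/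

/-- `v 0, …, v (d - 1)` is a full `B`-orthonormal system of generalized eigenvectors of `(A, B)`,
`A v_i = λ_i B v_i`, i.e. of eigenvectors of `B⁻¹ A`, with `|λ_0| ≥ |λ_1| ≥ …`. -/
structure IsGeneralizedEigensystem {d : ℕ} (A B : Matrix (Fin d) (Fin d) ℝ) (lam : Fin d → ℝ)
    (v : Fin d → Fin d → ℝ) : Prop where
  eigen : ∀ i, A *ᵥ v i = lam i • (B *ᵥ v i)
  orthonormal : ∀ i j, v i ⬝ᵥ (B *ᵥ v j) = if i = j then 1 else 0
  antitone : ∀ i j, i ≤ j → |lam j| ≤ |lam i|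

/-- The `d × k` matrix with columns `v 0, …, v (k - 1)`. -/
def topMatrix {d k : ℕ} (h : k ≤ d) (v : Fin d → Fin d → ℝ) : Matrix (Fin d) (Fin k) ℝ :=
  Matrix.of fun i j => v (Fin.castLE h j) i

/-- The smallest singular value of a `k × k` matrix. -/
def sigmaMin {k : ℕ} (M : Matrix (Fin k) (Fin k) ℝ) : ℝ :=
  (Matrix.toEuclideanLin M).singularValues (k - 1)

/-- The largest principal angle, in the `B`-norm, between the column spans of two `B`-orthonormal
matrices. -/
def angle {d k : ℕ} (B : Matrix (Fin d) (Fin d) ℝ) (W V : Matrix (Fin d) (Fin k) ℝ) : ℝ :=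
  Real.arccos (sigmaMin (Vᵀ * B * W))

/-- `W` is a `B`-orthonormal estimate of `V` with error at most `ε`. -/
def AchievesError {d k : ℕ} (B : Matrix (Fin d) (Fin d) ℝ) (V : Matrix (Fin d) (Fin k) ℝ) (ε : ℝ)
    (W : Matrix (Fin d) (Fin k) ℝ) : Prop :=
  Wᵀ * B * W = 1 ∧ Real.sin (angle B W V) ≤ ε

/-- The number of iterations, `(2 / ρ) log (1 / (ε cos θ₀))` rounded up. -/
def numIter (ρ θ₀ ε : ℝ) : ℕ := ⌈2 / ρ * Real.log (1 / (ε * Real.cos θ₀))⌉₊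

/-- The solver accuracy in the initial phase. -/
def accuracyInit (k : ℕ) (ρ γ θ₀ : ℝ) : ℝ := ρ ^ 2 * Real.cos θ₀ ^ 4 / (64 * k * γ ^ 2)

/-- The solver accuracy in the main phase. -/
def accuracyMain (k : ℕ) (ρ γ : ℝ) : ℝ := ρ ^ 2 / (64 * k * γ ^ 2)

/-- The solver accuracy in iteration `t`: the initial phase consists of the first
`⌈(2 / ρ) log (tan θ₀)⌉` iterations (none if `tan θ₀ ≤ 1`). -/
def accuracy (k : ℕ) (ρ γ θ₀ : ℝ) (t : ℕ) : ℝ :=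
  if t < ⌈2 / ρ * Real.log (Real.tan θ₀)⌉₊ then accuracyInit k ρ γ θ₀ else accuracyMain k ρ γ

end GenEig

end

/-! In coordinates with respect to the generalized eigenvectors, the `B`-inner product becomes the
Euclidean one and `B⁻¹A` becomes `diag(lam)`. Let `U` be the coordinates of a `B`-orthonormal `W`.
The condition `tan θ(W, V) ≤ τ` then says that every vector in the column space of `U` has its last
`d - k` coordinates at most `τ` times its first `k` in norm (`TangentLE`). Multiplication by
`diag(lam)` improves `τ` to `(1 - ρ) τ`, and Gram–Schmidt changes nothing since it preserves the
column space.

The solver error must not spoil this. The starting point `W Γ` is the projection of the exact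
solution onto the span of `W`, so its error is a Rayleigh–Ritz residual, of size proportional to
`sin θ` (`residual_le`). A fixed relative accuracy `δ` therefore gives an error that shrinks with
`τ`, and `δ` need not depend on `ε`. `tangent_contraction` concludes that `τ` becomes at most `(1 -
ρ/2) τ`. While `τ` may exceed one, the error must also not swamp the first `k` coordinates; this
costs the factor `cos⁴ θ₀` in `δ` during the first phase. After `T` steps the tangent is at most
`exp(-ρT/2) tan θ₀ ≤ ε sin θ₀` (`genELinK_achievesError`).

For the cost, the count of initial iterations is charged to `log (1 / cos θ₀)` and the remaining
ones to `log (2 / ε)` (`initIter_le`, `mainIter_le`); the linear algebra in one iteration is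
`O(nnz(A) k + nnz(B) k + d k²)`. For accelerated gradient descent, each eigencoordinate of `B`
evolves independently, and a quadratic energy contracts by `1 - 1/√κ` (`agd_energy_step`); its cost
is `O(nnz(B))` per step because a positive definite matrix has at least `d` nonzero entries. -/

namespace GenEig

/-! ### Values and step counts of timed computations -/

namespace Timed

variable {α β σ : Type}

@[simp] theorem pure_val (a : α) : (pure a : Timed α).val = a := rfl
@[simp] theorem pure_time (a : α) : (pure a : Timed α).time = 0 := rfl
@[simp] theorem bind_val (x : Timed α) (f : α → Timed β) :
    (x >>= f).val = (f x.val).val := rfl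
@[simp] theorem bind_time (x : Timed α) (f : α → Timed β) :
    (x >>= f).time = x.time + (f x.val).time := rfl
@[simp] theorem tick_time (n : ℕ) : (tick n).time = n := rfl
@[simp] theorem add_val (x y : ℝ) : (add x y).val = x + y := rfl
@[simp] theorem add_time (x y : ℝ) : (add x y).time = 1 := rfl
@[simp] theorem sub_val (x y : ℝ) : (sub x y).val = x - y := rfl
@[simp] theorem sub_time (x y : ℝ) : (sub x y).time = 1 := rfl
@[simp] theorem mul_val (x y : ℝ) : (mul x y).val = x * y := rfl
@[simp] theorem mul_time (x y : ℝ) : (mul x y).time = 1 := rfl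
@[simp] theorem div_val (x y : ℝ) : (div x y).val = x / y := rfl
@[simp] theorem div_time (x y : ℝ) : (div x y).time = 1 := rfl
@[simp] theorem sqrt_val (x : ℝ) : (Timed.sqrt x).val = Real.sqrt x := rfl
@[simp] theorem sqrt_time (x : ℝ) : (Timed.sqrt x).time = 1 := rfl
@[simp] theorem sumOver_val {n : ℕ} (s : Finset (Fin n)) (f : Fin n → Timed ℝ) :
    (sumOver s f).val = ∑ i ∈ s, (f i).val := rfl
@[simp] theorem sumOver_time {n : ℕ} (s : Finset (Fin n)) (f : Fin n → Timed ℝ) :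
    (sumOver s f).time = ∑ i ∈ s, ((f i).time + 1) := rfl
@[simp] theorem vec_val {n : ℕ} (f : Fin n → Timed ℝ) :
    (vec f).val = fun i => (f i).val := rfl
@[simp] theorem vec_time {n : ℕ} (f : Fin n → Timed ℝ) :
    (vec f).time = ∑ i, ((f i).time + 1) := rfl
@[simp] theorem mat_val {m n : ℕ} (f : Fin m → Fin n → Timed ℝ) :
    (mat f).val = Matrix.of fun i j => (f i j).val := rfl
@[simp] theorem mat_time {m n : ℕ} (f : Fin m → Fin n → Timed ℝ) :
    (mat f).time = ∑ i, ∑ j, ((f i j).time + 1) := rfl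

theorem vec_time_le {n c : ℕ} {f : Fin n → Timed ℝ} (h : ∀ i, (f i).time ≤ c) :
    (vec f).time ≤ n * (c + 1) := by
  rw [vec_time]
  calc ∑ i, ((f i).time + 1) ≤ ∑ _i : Fin n, (c + 1) :=
        Finset.sum_le_sum fun i _ => Nat.add_le_add_right (h i) 1
    _ = n * (c + 1) := by simp

theorem mat_time_le {m n c : ℕ} {f : Fin m → Fin n → Timed ℝ} (h : ∀ i j, (f i j).time ≤ c) :
    (mat f).time ≤ m * (n * (c + 1)) := by
  rw [mat_time]
  calc ∑ i, ∑ j, ((f i j).time + 1) ≤ ∑ _i : Fin m, ∑ _j : Fin n, (c + 1) :=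
        Finset.sum_le_sum fun i _ => Finset.sum_le_sum fun j _ => Nat.add_le_add_right (h i j) 1
    _ = m * (n * (c + 1)) := by simp

theorem sumOver_time_le {n c : ℕ} {s : Finset (Fin n)} {f : Fin n → Timed ℝ}
    (h : ∀ i, (f i).time ≤ c) : (sumOver s f).time ≤ n * (c + 1) := by
  rw [sumOver_time]
  calc ∑ i ∈ s, ((f i).time + 1) ≤ ∑ i, ((f i).time + 1) :=
        Finset.sum_le_sum_of_subset (Finset.subset_univ s)
    _ ≤ n * (c + 1) := by simpa using vec_time_le h

/-- The invariant sees the iteration number, so it can express a bound that decays geometrically. -/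
theorem loop_invariant {body : ℕ → σ → Timed σ} (P : ℕ → σ → Prop) {n : ℕ} {s : σ}
    (h0 : P 0 s) (hs : ∀ i < n, ∀ s, P i s → P (i + 1) (body i s).val) :
    P n (loop body n s).val := by
  induction n with
  | zero => exact h0
  | succ n ih =>
    exact hs n n.lt_succ_self _ (ih fun i hi => hs i (hi.trans n.lt_succ_self))

/-- The per-iteration bound varies with `i`, as the solver accuracy does, and is real because solver
costs are. -/
theorem loop_time_le {body : ℕ → σ → Timed σ} {c : ℕ → ℝ} {n : ℕ}
    (h : ∀ i < n, ∀ s, ((body i s).time : ℝ) ≤ c i) (s : σ) :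
    ((loop body n s).time : ℝ) ≤ ∑ i ∈ Finset.range n, c i := by
  induction n with
  | zero => simp [loop]
  | succ n ih =>
    rw [Finset.sum_range_succ]
    have := ih fun i hi => h i (hi.trans n.lt_succ_self)
    have := h n n.lt_succ_self (loop body n s).val
    simp only [loop, bind_time, Nat.cast_add]
    linarith

theorem loop_time_le_mul {body : ℕ → σ → Timed σ} {c : ℕ} (h : ∀ i s, (body i s).time ≤ c)
    (n : ℕ) (s : σ) : (loop body n s).time ≤ n * c := by
  have := loop_time_le (n := n) (c := fun _ => (c : ℝ))
    (fun i _ s => by exact_mod_cast h i s) s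
  simp only [Finset.sum_const, Finset.card_range, nsmul_eq_mul] at this
  exact_mod_cast this

theorem forFin_invariant {n : ℕ} {body : Fin n → σ → Timed σ} (P : ℕ → σ → Prop) {s : σ}
    (h0 : P 0 s) (hs : ∀ (i : Fin n) s, P i s → P (i + 1) (body i s).val) :
    P n (forFin body s).val :=
  loop_invariant P h0 fun i hi s h => by simpa [hi] using hs ⟨i, hi⟩ s h

theorem forFin_time_le {n c : ℕ} {body : Fin n → σ → Timed σ} (h : ∀ i s, (body i s).time ≤ c)
    (s : σ) : (forFin body s).time ≤ n * c := by
  refine loop_time_le_mul (fun i s => ?_) n s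
  by_cases hi : i < n
  · simpa [hi] using h ⟨i, hi⟩ s
  · simp [hi]

end Timed

open Timed

/-! ## Costs of the linear algebra routines -/

theorem sum_card_rowSupport {m n : ℕ} (S : Matrix (Fin m) (Fin n) ℝ) :
    ∑ i, (rowSupport S i).card = nnz S := by
  simp only [nnz, rowSupport, Finset.card_filter, Fintype.sum_prod_type]

theorem sparseMulVec_time {m n : ℕ} (S : Matrix (Fin m) (Fin n) ℝ) (x : Fin n → ℝ) :
    (sparseMulVec S x).time = 2 * nnz S + m := by
  simp [sparseMulVec, Finset.sum_add_distrib, ← sum_card_rowSupport, Finset.mul_sum, mul_comm]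

theorem sparseMul_time {m n k : ℕ} (S : Matrix (Fin m) (Fin n) ℝ) (X : Matrix (Fin n) (Fin k) ℝ) :
    (sparseMul S X).time = 2 * nnz S * k + m * k := by
  simp only [sparseMul, mat_time, sumOver_time, mul_time, Finset.sum_const, smul_eq_mul,
    Finset.card_univ, Fintype.card_fin, Finset.sum_add_distrib, ← Finset.mul_sum,
    ← Finset.sum_mul, sum_card_rowSupport, mul_one, Nat.reduceAdd]
  ring

theorem denseMul_time {m n k : ℕ} (X : Matrix (Fin m) (Fin n) ℝ) (Y : Matrix (Fin n) (Fin k) ℝ) :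
    (denseMul X Y).time = m * (k * (2 * n + 1)) := by
  simp [denseMul, mul_comm]

theorem dot_time {n : ℕ} (x y : Fin n → ℝ) : (dot x y).time = 2 * n := by
  simp [dot, mul_comm]

theorem gaussJordan_time_le {k m : ℕ} (G : Matrix (Fin k) (Fin k) ℝ)
    (H : Matrix (Fin k) (Fin m) ℝ) :
    (gaussJordan G H).time ≤ k * (5 * (k * k) + 5 * (k * m)) := by
  -- For `1 ≤ k` the cost of normalizing the pivot row, linear in `k + m`, is absorbed by the
  -- elimination.
  rcases Nat.eq_zero_or_pos k with rfl | hk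
  · simp [gaussJordan, forFin, loop]
  unfold gaussJordan
  rw [bind_time, pure_time, add_zero]
  refine forFin_time_le (fun p s => ?_) _
  simp only [bind_time, pure_time, add_zero]
  have h1 : ∀ g : Fin k → ℝ, (mat fun i j => if i = p then pure (g j) else do
      let a ← mul (s.1 i p) (g j)
      sub (s.1 i j) a).time ≤ k * (k * (2 + 1)) := fun g =>
    mat_time_le fun i j => by split_ifs <;> simp
  have h2 : ∀ g : Fin m → ℝ, (mat fun i j => if i = p then pure (g j) else do
      let a ← mul (s.1 i p) (g j)
      sub (s.2 i j) a).time ≤ k * (m * (2 + 1)) := fun g =>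
    mat_time_le fun i j => by split_ifs <;> simp
  have h3 : (vec fun j => div (s.1 p j) (s.1 p p)).time ≤ k * (1 + 1) :=
    vec_time_le fun j => by simp
  have h4 : (vec fun j => div (s.2 p j) (s.1 p p)).time ≤ m * (1 + 1) :=
    vec_time_le fun j => by simp
  have h5 := h1 (vec fun j => div (s.1 p j) (s.1 p p)).val
  have h6 := h2 (vec fun j => div (s.2 p j) (s.1 p p)).val
  have h7 : k ≤ k * k := Nat.le_mul_of_pos_left k hk
  have h8 : m ≤ k * m := Nat.le_mul_of_pos_left m hk
  linarith

theorem gramSchmidt_time_le {d k : ℕ} (hk : 0 < k) (hd : 0 < d) (B : Matrix (Fin d) (Fin d) ℝ)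
    (W : Matrix (Fin d) (Fin k) ℝ) :
    (gramSchmidt B W).time ≤ k * (4 * nnz B + 16 * (d * k)) := by
  unfold gramSchmidt
  refine forFin_time_le (fun j Q => ?_) _
  simp only [bind_time, pure_time, add_zero, sparseMulVec_time, dot_time, sqrt_time]
  have h1 : ∀ w : Fin d → ℝ, (vec fun i : Fin k =>
      if i < j then dot (fun l => Q l i) w else pure 0).time ≤ k * (2 * d + 1) := fun w =>
    vec_time_le fun i => by split_ifs <;> simp [dot_time]
  have h2 : ∀ c : Fin k → ℝ, (vec fun l => do
      let s ← sumOver (Finset.univ.filter fun i => i < j) fun i => mul (c i) (Q l i)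
      sub (W l j) s).time ≤ d * ((k * (1 + 1) + 1) + 1) := fun c =>
    vec_time_le fun l => by
      rw [bind_time, sub_time]
      exact Nat.add_le_add_right (sumOver_time_le fun i => by simp) 1
  have h3 : ∀ (u : Fin d → ℝ) (r : ℝ), (vec fun l => div (u l) r).time ≤ d * (1 + 1) :=
    fun u r => vec_time_le fun l => by simp
  have h4 := h1 (sparseMulVec B fun l => W l j).val
  have h5 := h2 (vec fun i : Fin k =>
      if i < j then dot (fun l => Q l i) (sparseMulVec B fun l => W l j).val else pure 0).val
  refine (Nat.add_le_add_left (Nat.add_le_add h4 (Nat.add_le_add h5 (Nat.add_le_add_left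
    (Nat.add_le_add_left (Nat.add_le_add_left (h3 _ _) _) _) _))) _).trans ?_
  have h7 : d ≤ d * k := Nat.le_mul_of_pos_right d hk
  have h8 : k ≤ d * k := Nat.le_mul_of_pos_left k hd
  have h9 : 1 ≤ d := hd
  nlinarith

/-- Six scalar operations precede the loop. An iteration is one sparse product, `2 nnz(B) + d`, and
two vector updates with three operations and one store per entry, `8d`. -/
theorem agd_time {d : ℕ} (B : Matrix (Fin d) (Fin d) ℝ) (α β : ℝ) (N : ℕ) (b u₀ : Fin d → ℝ) :
    (agd B α β N b u₀).time ≤ 6 + N * (2 * nnz B + 9 * d) := by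
  have h : ∀ (f : ℕ → (Fin d → ℝ) × (Fin d → ℝ) → Timed ((Fin d → ℝ) × (Fin d → ℝ)))
      (_ : ∀ i s, (f i s).time ≤ 2 * nnz B + 9 * d) (s),
      (loop f N s).time ≤ N * (2 * nnz B + 9 * d) := fun f hf s => loop_time_le_mul hf N s
  unfold agd
  simp only [bind_time, pure_time, add_zero, div_time, sub_time, add_time, sqrt_time]
  refine le_trans (b := 1 + (1 + (1 + (1 + (1 + (1 + N * (2 * nnz B + 9 * d))))))) ?_ (by omega)
  gcongr
  refine h _ (fun i s => ?_) _
  simp [sparseMulVec_time]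
  omega

theorem columns_time {d k : ℕ} (f : Fin k → Timed (Fin d → ℝ)) :
    (columns f).time = ∑ j, ((f j).time + 1) := rfl

/-! ## Correctness of the linear algebra routines -/

theorem sparseMulVec_val {m n : ℕ} (S : Matrix (Fin m) (Fin n) ℝ) (x : Fin n → ℝ) :
    (sparseMulVec S x).val = S *ᵥ x := by
  ext i
  simp only [sparseMulVec, vec_val, sumOver_val, mul_val, Matrix.mulVec, dotProduct, rowSupport]
  refine Finset.sum_subset (Finset.filter_subset _ _) fun l _ hl => ?_
  simp only [Finset.mem_filter, Finset.mem_univ, true_and, not_not] at hl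
  simp [hl]

theorem sparseMul_val {m n k : ℕ} (S : Matrix (Fin m) (Fin n) ℝ) (X : Matrix (Fin n) (Fin k) ℝ) :
    (sparseMul S X).val = S * X := by
  ext i j
  exact congrFun (sparseMulVec_val S (X.col j)) i

theorem denseMul_val {m n k : ℕ} (X : Matrix (Fin m) (Fin n) ℝ) (Y : Matrix (Fin n) (Fin k) ℝ) :
    (denseMul X Y).val = X * Y := by
  ext i j
  simp [denseMul, Matrix.mul_apply]

theorem dot_val {n : ℕ} (x y : Fin n → ℝ) : (dot x y).val = x ⬝ᵥ y := rfl

/-- Every `W_t` is `B`-orthonormal, so elimination is only ever run on the identity, where each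
pivot step leaves the state unchanged. -/
theorem gaussJordan_one_val {k m : ℕ} (H : Matrix (Fin k) (Fin m) ℝ) :
    (gaussJordan 1 H).val = H := by
  unfold gaussJordan
  rw [bind_val, pure_val]
  refine congrArg Prod.snd (forFin_invariant (fun _ s => s = (1, H)) rfl fun p s hs => ?_)
  subst hs
  simp only [bind_val, pure_val, mat_val, vec_val, div_val, Matrix.one_apply_eq, div_one,
    Prod.mk.injEq]
  constructor <;> ext i j <;> by_cases h : i = p <;> simp [h, Matrix.one_apply]

theorem dotProduct_mulVec_mulVec {d k : ℕ} (B : Matrix (Fin d) (Fin d) ℝ)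
    (Q : Matrix (Fin d) (Fin k) ℝ) (x : Fin d → ℝ) (c : Fin k → ℝ) :
    x ⬝ᵥ (B *ᵥ (Q *ᵥ c)) = ∑ l, c l * (x ⬝ᵥ (B *ᵥ Q.col l)) := by
  have : Q *ᵥ c = ∑ l, c l • Q.col l := by
    ext i
    simp [Matrix.mulVec, dotProduct, mul_comm]
  simp only [this, Matrix.mulVec_sum, Matrix.mulVec_smul, dotProduct_sum, dotProduct_smul,
    smul_eq_mul]

theorem dotProduct_mulVec_comm {d : ℕ} {B : Matrix (Fin d) (Fin d) ℝ} (hB : B.PosDef)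
    (x y : Fin d → ℝ) : x ⬝ᵥ (B *ᵥ y) = y ⬝ᵥ (B *ᵥ x) := by
  have : Bᵀ = B := by simpa [Matrix.IsHermitian] using hB.isHermitian
  rw [Matrix.dotProduct_mulVec, ← Matrix.mulVec_transpose, this, dotProduct_comm]

theorem normSqB_pos {d : ℕ} {B : Matrix (Fin d) (Fin d) ℝ} (hB : B.PosDef) {u : Fin d → ℝ}
    (hu : u ≠ 0) : 0 < normSqB B u := by
  have := hB.dotProduct_mulVec_pos hu
  rwa [star_trivial] at this

theorem normSqB_smul {d : ℕ} (B : Matrix (Fin d) (Fin d) ℝ) (c : ℝ) (u : Fin d → ℝ) :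
    normSqB B (c • u) = c ^ 2 * normSqB B u := by
  simp only [normSqB, Matrix.mulVec_smul, dotProduct_smul, smul_dotProduct, smul_eq_mul]
  ring

/-- The output columns of Gram–Schmidt are `B`-orthogonal combinations of the input columns, each
one `B`-normalized or zero; a zero column reveals a linear dependence of the input columns. -/
theorem gramSchmidt_spec {d k : ℕ} {B : Matrix (Fin d) (Fin d) ℝ} (hB : B.PosDef)
    (W : Matrix (Fin d) (Fin k) ℝ) :
    (∀ j, ∃ r, (gramSchmidt B W).val.col j = W *ᵥ r) ∧
    (∀ i j, i ≠ j →
      (gramSchmidt B W).val.col i ⬝ᵥ (B *ᵥ (gramSchmidt B W).val.col j) = 0) ∧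
    (∀ j, normSqB B ((gramSchmidt B W).val.col j) = 1 ∨ (gramSchmidt B W).val.col j = 0) ∧
    (∀ j, (gramSchmidt B W).val.col j = 0 → ∃ z, z ≠ 0 ∧ W *ᵥ z = 0) := by
  -- The clause `r l = 0` for `j < l` keeps the change of basis triangular. Column `j` of `W` then
  -- enters the unnormalized `u` with coefficient one, so `u = 0` is a nontrivial linear relation.
  set P : ℕ → Matrix (Fin d) (Fin k) ℝ → Prop := fun n Q =>
    (∀ j : Fin k, (j : ℕ) < n → ∃ r, Q.col j = W *ᵥ r ∧ ∀ l, j < l → r l = 0) ∧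
    (∀ i j : Fin k, i < j → (j : ℕ) < n → Q.col i ⬝ᵥ (B *ᵥ Q.col j) = 0) ∧
    (∀ j : Fin k, (j : ℕ) < n → normSqB B (Q.col j) = 1 ∨ Q.col j = 0) ∧
    (∀ j : Fin k, (j : ℕ) < n → Q.col j = 0 → ∃ z, z ≠ 0 ∧ W *ᵥ z = 0) with hP
  suffices h : P k (gramSchmidt B W).val by
    obtain ⟨h1, h2, h3, h4⟩ := h
    refine ⟨fun j => (h1 j j.2).imp fun r hr => hr.1, fun i j hij => ?_, fun j => h3 j j.2,
      fun j => h4 j j.2⟩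
    rcases lt_or_gt_of_ne hij with h | h
    · exact h2 i j h j.2
    · rw [dotProduct_mulVec_comm hB]
      exact h2 j i h i.2
  refine forFin_invariant P ⟨by simp, by simp, by simp, by simp⟩ ?_
  rintro j Q ⟨h1, h2, h3, h4⟩
  simp only [bind_val, pure_val, sparseMulVec_val, dot_val, sqrt_val, vec_val, div_val, sub_val,
    sumOver_val, mul_val]
  set c : Fin k → ℝ := fun i => if i < j then Q.col i ⬝ᵥ (B *ᵥ W.col j) else 0 with hc
  set u : Fin d → ℝ := W.col j - Q *ᵥ c with hu
  have hc' : ∀ i, (if i < j then dot (fun l => Q l i) (B *ᵥ fun l => W l j)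
      else pure 0).val = c i := by
    intro i
    simp only [hc]
    split_ifs <;> rfl
  have hu' : ∀ l, W l j - ∑ i with i < j, c i * Q l i = u l := by
    intro l
    simp only [hu, Pi.sub_apply, Matrix.col_apply, Matrix.mulVec, dotProduct]
    congr 1
    rw [Finset.sum_filter]
    refine Finset.sum_congr rfl fun i _ => ?_
    by_cases hi : i < j <;> simp [hc, hi, mul_comm]
  simp only [hc', hu']
  have hnn : u ⬝ᵥ (B *ᵥ u) = normSqB B u := rfl
  rw [hnn]
  set s := Real.sqrt (normSqB B u) with hs
  have hq : (fun i => u i / s) = s⁻¹ • u := by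
    ext i
    simp [div_eq_inv_mul]
  rw [hq]
  have colj : (Q.updateCol j (s⁻¹ • u)).col j = s⁻¹ • u := by
    ext i; simp
  have coli : ∀ i, i ≠ j → (Q.updateCol j (s⁻¹ • u)).col i = Q.col i := by
    intro i hi; ext l; simp [Matrix.updateCol_ne hi]
  have hlt : ∀ i : Fin k, (i : ℕ) < j + 1 → i ≠ j → i < j := fun i hi hij => by
    have : (i : ℕ) ≠ j := fun h => hij (Fin.ext h)
    exact Fin.lt_def.2 (by omega)
  -- Division by zero yields zero, so a vanishing output column can only come from `u = 0`.
  have hs0 : s = 0 → u = 0 := fun h => by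
    by_contra hne
    exact (Real.sqrt_pos.2 (normSqB_pos hB hne)).ne' h
  -- `u` is a combination of the columns of `W` up to `j`, with coefficient one at `j`
  have hcomb : ∃ r : Fin k → ℝ, u = W *ᵥ r ∧ r j = 1 ∧ ∀ l, j < l → r l = 0 := by
    choose! r hr using h1
    refine ⟨Pi.single j 1 - ∑ i, c i • (if i < j then r i else 0), ?_, ?_, fun l hl => ?_⟩
    · rw [hu, Matrix.mulVec_sub, Matrix.mulVec_single_one, Matrix.mulVec_sum]
      congr 1
      ext l
      rw [Finset.sum_apply, Matrix.mulVec, dotProduct]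
      refine Finset.sum_congr rfl fun i _ => ?_
      by_cases hi : i < j
      · rw [if_pos hi, Matrix.mulVec_smul, ← (hr i hi).1]
        simp [mul_comm]
      · simp [hi, hc]
    · simp only [Pi.sub_apply, Pi.single_eq_same, Finset.sum_apply, Pi.smul_apply, smul_eq_mul,
        sub_eq_self]
      refine Finset.sum_eq_zero fun i _ => ?_
      by_cases hi : i < j
      · simp [hi, (hr i hi).2 j hi]
      · simp [hi]
    · simp only [Pi.sub_apply, Finset.sum_apply, Pi.smul_apply, smul_eq_mul]
      rw [Pi.single_eq_of_ne hl.ne', zero_sub, neg_eq_zero]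
      refine Finset.sum_eq_zero fun i _ => ?_
      by_cases hi : i < j
      · simp [hi, (hr i hi).2 l (hi.trans hl)]
      · simp [hi]
  have horth : ∀ i, i < j → Q.col i ⬝ᵥ (B *ᵥ u) = 0 := by
    intro i hi
    rw [hu, Matrix.mulVec_sub, dotProduct_sub, dotProduct_mulVec_mulVec,
      Finset.sum_eq_single i]
    -- Only the term `l = i` survives: it cancels if column `i` is normalized, and everything
    -- vanishes if that column is zero.
    · rcases h3 i hi with h | h
      · rw [normSqB] at h
        simp [h, hc, hi]
      · simp [h]
    · intro l _ hl
      by_cases hlj : l < j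
      · rcases lt_or_gt_of_ne hl with h | h
        · rw [dotProduct_mulVec_comm hB, h2 l i h hi, mul_zero]
        · rw [h2 i l h hlj, mul_zero]
      · simp [hc, hlj]
    · simp
  obtain ⟨r, hr, hrj, hrl⟩ := hcomb
  refine ⟨fun i hi => ?_, fun i l hil hl => ?_, fun i hi => ?_, fun i hi => ?_⟩
  · by_cases hij : i = j
    · subst hij
      exact ⟨s⁻¹ • r, by rw [colj, hr, Matrix.mulVec_smul], fun l hl => by simp [hrl l hl]⟩
    · rw [coli i hij]
      exact h1 i (hlt i hi hij)
  · by_cases hlj : l = j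
    · subst hlj
      rw [coli i hil.ne, colj, Matrix.mulVec_smul, dotProduct_smul, horth i hil, smul_zero]
    · have := hlt l hl hlj
      rw [coli l hlj, coli i (hil.trans this).ne]
      exact h2 i l hil this
  · by_cases hij : i = j
    · subst hij
      rw [colj]
      by_cases hu0 : u = 0
      · right; rw [hu0, smul_zero]
      · left
        have := normSqB_pos hB hu0
        rw [normSqB_smul, inv_pow, hs, Real.sq_sqrt this.le, inv_mul_cancel₀ this.ne']
    · rw [coli i hij]
      exact h3 i (hlt i hi hij)
  · by_cases hij : i = j
    · subst hij
      rw [colj]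
      intro h
      refine ⟨r, fun h0 => by simp [h0] at hrj, ?_⟩
      rw [← hr]
      rcases smul_eq_zero.1 h with h | h
      · exact hs0 (inv_eq_zero.1 h)
      · exact h
    · rw [coli i hij]
      exact h4 i (hlt i hi hij)

theorem transpose_mul_mul_apply {d k : ℕ} (B : Matrix (Fin d) (Fin d) ℝ)
    (U W : Matrix (Fin d) (Fin k) ℝ) (i j : Fin k) :
    (Uᵀ * B * W) i j = U.col i ⬝ᵥ (B *ᵥ W.col j) := by
  rw [Matrix.mul_assoc, Matrix.mul_apply']
  rfl

/-- For the initial matrix, nondegeneracy is read off the output through the angle; later iterates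
use full column rank of the input. -/
theorem gramSchmidt_orthonormal_of_col_ne_zero {d k : ℕ} {B : Matrix (Fin d) (Fin d) ℝ}
    (hB : B.PosDef) (W : Matrix (Fin d) (Fin k) ℝ)
    (h : ∀ j, (gramSchmidt B W).val.col j ≠ 0) :
    (gramSchmidt B W).valᵀ * B * (gramSchmidt B W).val = 1 := by
  obtain ⟨-, h2, h3, -⟩ := gramSchmidt_spec hB W
  ext i j
  rw [transpose_mul_mul_apply]
  by_cases hij : i = j
  · subst hij
    rw [Matrix.one_apply_eq]
    exact (h3 i).resolve_right (h i)
  · rw [h2 i j hij, Matrix.one_apply_ne hij]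

theorem gramSchmidt_orthonormal {d k : ℕ} {B : Matrix (Fin d) (Fin d) ℝ}
    (hB : B.PosDef) (W : Matrix (Fin d) (Fin k) ℝ) (h : ∀ z, W *ᵥ z = 0 → z = 0) :
    (gramSchmidt B W).valᵀ * B * (gramSchmidt B W).val = 1 :=
  gramSchmidt_orthonormal_of_col_ne_zero hB W fun j hj =>
    let ⟨z, hz, hz'⟩ := (gramSchmidt_spec hB W).2.2.2 j hj
    hz (h z hz')

/-- The tangent bound quantifies over all vectors of a column space, so this inclusion is enough to
carry it through the orthonormalization. -/
theorem gramSchmidt_mulVec {d k : ℕ} {B : Matrix (Fin d) (Fin d) ℝ}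
    (hB : B.PosDef) (W : Matrix (Fin d) (Fin k) ℝ) (z : Fin k → ℝ) :
    ∃ y, (gramSchmidt B W).val *ᵥ z = W *ᵥ y := by
  choose r hr using (gramSchmidt_spec hB W).1
  refine ⟨∑ j, z j • r j, ?_⟩
  rw [Matrix.mulVec_sum]
  simp only [Matrix.mulVec_smul, ← hr]
  ext i
  simp [Matrix.mulVec, dotProduct, mul_comm]

/-- The diagonal is positive. This absorbs the `O(d)` vector operations of gradient descent into
`nnz(B)`. -/
theorem nnz_ge_of_posDef {d : ℕ} {B : Matrix (Fin d) (Fin d) ℝ} (hB : B.PosDef) : d ≤ nnz B := by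
  calc d = ((Finset.univ : Finset (Fin d)).image fun i => (i, i)).card := by
        rw [Finset.card_image_of_injective _ fun a b h => (Prod.ext_iff.1 h).1]
        simp
    _ ≤ nnz B := Finset.card_le_card fun p hp => by
        obtain ⟨i, -, rfl⟩ := Finset.mem_image.1 hp
        simpa using hB.diag_pos.ne'

/-! ## Sums of squares -/

/-- The triangle inequality in `ℓ²(s)`, in squared form, by Cauchy–Schwarz. -/
theorem sum_add_sq_le {ι : Type*} (s : Finset ι) {a b : ι → ℝ} {p q : ℝ} (hp : 0 ≤ p) (hq : 0 ≤ q)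
    (ha : ∑ i ∈ s, a i ^ 2 ≤ p ^ 2) (hb : ∑ i ∈ s, b i ^ 2 ≤ q ^ 2) :
    ∑ i ∈ s, (a i + b i) ^ 2 ≤ (p + q) ^ 2 := by
  have h1 : (∑ i ∈ s, a i * b i) ^ 2 ≤ (p * q) ^ 2 := by
    rw [mul_pow]
    exact (Finset.sum_mul_sq_le_sq_mul_sq s a b).trans
      (mul_le_mul ha hb (Finset.sum_nonneg fun i _ => sq_nonneg _) (sq_nonneg p))
  have h2 := abs_le_of_sq_le_sq' h1 (mul_nonneg hp hq)
  have h3 : ∑ i ∈ s, (a i + b i) ^ 2 =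
      ∑ i ∈ s, a i ^ 2 + 2 * ∑ i ∈ s, a i * b i + ∑ i ∈ s, b i ^ 2 := by
    rw [Finset.mul_sum, ← Finset.sum_add_distrib, ← Finset.sum_add_distrib]
    exact Finset.sum_congr rfl fun i _ => by ring
  rw [h3]
  nlinarith [h2.2]

/-- The reverse triangle inequality, from `a = (a + b) + (-b)`. -/
theorem le_sum_add_sq {ι : Type*} (s : Finset ι) {a b : ι → ℝ} {p q : ℝ} (hq : 0 ≤ q)
    (hqp : q ≤ p) (ha : p ^ 2 ≤ ∑ i ∈ s, a i ^ 2) (hb : ∑ i ∈ s, b i ^ 2 ≤ q ^ 2) :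
    (p - q) ^ 2 ≤ ∑ i ∈ s, (a i + b i) ^ 2 := by
  set r := ∑ i ∈ s, (a i + b i) ^ 2 with hr
  have hr0 : 0 ≤ r := Finset.sum_nonneg fun i _ => sq_nonneg _
  have h := sum_add_sq_le s (a := fun i => a i + b i) (b := fun i => -b i) (Real.sqrt_nonneg r) hq
    (by rw [Real.sq_sqrt hr0]) (by simpa using hb)
  simp only [add_neg_cancel_right] at h
  have h2 : p ≤ Real.sqrt r + q :=
    le_of_sq_le_sq (ha.trans h) (add_nonneg (Real.sqrt_nonneg r) hq)
  have h3 : p - q ≤ Real.sqrt r := by linarith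
  calc (p - q) ^ 2 ≤ Real.sqrt r ^ 2 := pow_le_pow_left₀ (by linarith) h3 2
    _ = r := Real.sq_sqrt hr0

/-- The squared norm of the first `k` coordinates. -/
def topSq {d : ℕ} (k : ℕ) (x : Fin d → ℝ) : ℝ := ∑ i with i.val < k, x i ^ 2

/-- The squared norm of the coordinates after the first `k`. -/
def botSq {d : ℕ} (k : ℕ) (x : Fin d → ℝ) : ℝ := ∑ i with ¬ i.val < k, x i ^ 2

theorem topSq_add_botSq {d : ℕ} (k : ℕ) (x : Fin d → ℝ) : topSq k x + botSq k x = x ⬝ᵥ x := by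
  rw [topSq, botSq, Finset.sum_filter_add_sum_filter_not, dotProduct]
  exact Finset.sum_congr rfl fun i _ => sq (x i)

theorem topSq_nonneg {d : ℕ} (k : ℕ) (x : Fin d → ℝ) : 0 ≤ topSq k x :=
  Finset.sum_nonneg fun _ _ => sq_nonneg _

theorem botSq_nonneg {d : ℕ} (k : ℕ) (x : Fin d → ℝ) : 0 ≤ botSq k x :=
  Finset.sum_nonneg fun _ _ => sq_nonneg _

theorem sum_lt_eq_sum_castLE {d k : ℕ} (h : k ≤ d) (f : Fin d → ℝ) :
    ∑ i with i.val < k, f i = ∑ i : Fin k, f (Fin.castLE h i) := by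
  refine (Finset.sum_bij (fun (i : Fin k) _ => Fin.castLE h i) (fun i _ => by simp)
    (fun i _ j _ hij => by simpa using hij) (fun i hi => ?_) fun i _ => rfl).symm
  exact ⟨⟨i, by simpa using hi⟩, Finset.mem_univ _, rfl⟩

theorem dotProduct_self_nonneg' {n : ℕ} (x : Fin n → ℝ) : 0 ≤ x ⬝ᵥ x :=
  Finset.sum_nonneg fun _ _ => mul_self_nonneg _

theorem dotProduct_mulVec_self {m k : ℕ} (U : Matrix (Fin m) (Fin k) ℝ) (hU : Uᵀ * U = 1)
    (z : Fin k → ℝ) : (U *ᵥ z) ⬝ᵥ (U *ᵥ z) = z ⬝ᵥ z := by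
  rw [Matrix.dotProduct_mulVec, ← Matrix.mulVec_transpose, Matrix.mulVec_mulVec, hU,
    Matrix.one_mulVec]

/-- Pythagoras for the orthogonal projection `U Uᵀ`. -/
theorem dotProduct_sub_proj {m k : ℕ} (U : Matrix (Fin m) (Fin k) ℝ) (hU : Uᵀ * U = 1)
    (x : Fin m → ℝ) : (x - U *ᵥ (Uᵀ *ᵥ x)) ⬝ᵥ (x - U *ᵥ (Uᵀ *ᵥ x)) =
      x ⬝ᵥ x - (Uᵀ *ᵥ x) ⬝ᵥ (Uᵀ *ᵥ x) := by
  have h : x ⬝ᵥ (U *ᵥ (Uᵀ *ᵥ x)) = (Uᵀ *ᵥ x) ⬝ᵥ (Uᵀ *ᵥ x) := by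
    rw [Matrix.dotProduct_mulVec, ← Matrix.mulVec_transpose]
  rw [dotProduct_sub, sub_dotProduct, sub_dotProduct, dotProduct_mulVec_self U hU,
    dotProduct_comm (U *ᵥ (Uᵀ *ᵥ x)) x, h]
  ring

theorem dotProduct_add_self_le {n : ℕ} (x y : Fin n → ℝ) :
    (x + y) ⬝ᵥ (x + y) ≤ 2 * (x ⬝ᵥ x) + 2 * (y ⬝ᵥ y) := by
  have := dotProduct_self_nonneg' (x - y)
  simp only [sub_dotProduct, dotProduct_sub, add_dotProduct, dotProduct_add] at this ⊢
  linarith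

theorem dotProduct_sq_le {n : ℕ} (x y : Fin n → ℝ) : (x ⬝ᵥ y) ^ 2 ≤ (x ⬝ᵥ x) * (y ⬝ᵥ y) := by
  simpa [dotProduct, ← sq] using Finset.sum_mul_sq_le_sq_mul_sq Finset.univ x y

/-- The operator norm is at most the Frobenius norm; this turns the solver's total error into a
bound for every direction. -/
theorem mulVec_sq_le {m k : ℕ} (X : Matrix (Fin m) (Fin k) ℝ) (z : Fin k → ℝ) :
    (X *ᵥ z) ⬝ᵥ (X *ᵥ z) ≤ (∑ i, ∑ j, X i j ^ 2) * (z ⬝ᵥ z) := by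
  rw [dotProduct, Finset.sum_mul]
  refine Finset.sum_le_sum fun i _ => ?_
  have := dotProduct_sq_le (X i) z
  rw [← sq]
  refine this.trans_eq ?_
  simp [dotProduct, sq]

/-! ## One step of approximate orthogonal iteration, in eigencoordinates -/

section Step

variable {d k : ℕ} {U : Matrix (Fin d) (Fin k) ℝ} {τ : ℝ}

/-- A vector of the column space with zero top coordinates has zero bottom ones too, so the square
top block of `U` is injective, hence surjective. -/
theorem exists_topSq_coords (hkd : k ≤ d) (hU : Uᵀ * U = 1)
    (h : ∀ z, botSq k (U *ᵥ z) ≤ τ ^ 2 * topSq k (U *ᵥ z)) (x : Fin d → ℝ) :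
    ∃ z, ∀ i : Fin d, i.val < k → (U *ᵥ z) i = x i := by
  set C : Matrix (Fin k) (Fin k) ℝ := U.submatrix (Fin.castLE hkd) id with hC
  have hinj : Function.Injective C.mulVecLin := by
    rw [← LinearMap.ker_eq_bot, LinearMap.ker_eq_bot']
    intro z hz
    have h0 : topSq k (U *ᵥ z) = 0 := by
      rw [topSq, sum_lt_eq_sum_castLE hkd]
      refine Finset.sum_eq_zero fun i _ => ?_
      have : (U *ᵥ z) (Fin.castLE hkd i) = 0 := congrFun hz i
      rw [this]; norm_num
    have h1 := h z
    rw [h0, mul_zero] at h1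
    have h2 := topSq_add_botSq k (U *ᵥ z)
    rw [dotProduct_mulVec_self U hU, h0, zero_add] at h2
    exact dotProduct_self_eq_zero.1 (le_antisymm (h2 ▸ h1) (dotProduct_self_nonneg' z))
  obtain ⟨z, hz⟩ := (LinearMap.injective_iff_surjective.1 hinj) fun i => x (Fin.castLE hkd i)
  exact ⟨z, fun i hi => congrFun hz ⟨i, hi⟩⟩

/-- A vector in the span of the first `k` coordinate directions is almost preserved by the
projection onto the column space. -/
theorem top_vector_le_proj (hkd : k ≤ d) (hU : Uᵀ * U = 1)
    (h : ∀ z, botSq k (U *ᵥ z) ≤ τ ^ 2 * topSq k (U *ᵥ z)) (x : Fin d → ℝ)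
    (hx : ∀ i : Fin d, ¬ i.val < k → x i = 0) :
    x ⬝ᵥ x ≤ (1 + τ ^ 2) * ((Uᵀ *ᵥ x) ⬝ᵥ (Uᵀ *ᵥ x)) := by
  -- Lift `x` to the vector `U z` with the same top coordinates. Then `x ⬝ x = Uᵀx ⬝ z` and `|z|² ≤
  -- (1 + τ²) |x|²`, and Cauchy–Schwarz finishes.
  obtain ⟨z, hz⟩ := exists_topSq_coords hkd hU h x
  have h1 : x ⬝ᵥ x = (Uᵀ *ᵥ x) ⬝ᵥ z := by
    rw [Matrix.mulVec_transpose, ← Matrix.dotProduct_mulVec]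
    refine Finset.sum_congr rfl fun i _ => ?_
    by_cases hi : i.val < k
    · rw [hz i hi]
    · rw [hx i hi, zero_mul, zero_mul]
  have h2 : topSq k (U *ᵥ z) = x ⬝ᵥ x := by
    rw [← topSq_add_botSq k x]
    have hb : botSq k x = 0 := Finset.sum_eq_zero fun i hi => by
      rw [hx i (Finset.mem_filter.1 hi).2]; norm_num
    rw [hb, add_zero]
    exact Finset.sum_congr rfl fun i hi => by rw [hz i (Finset.mem_filter.1 hi).2]
  have h3 : z ⬝ᵥ z ≤ (1 + τ ^ 2) * (x ⬝ᵥ x) := by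
    rw [← dotProduct_mulVec_self U hU, ← topSq_add_botSq k, ← h2]
    linarith [h z]
  have h4 := dotProduct_sq_le (Uᵀ *ᵥ x) z
  rw [← h1] at h4
  have h5 := dotProduct_self_nonneg' x
  have h6 := dotProduct_self_nonneg' (Uᵀ *ᵥ x)
  rcases h5.eq_or_lt with h0 | h0
  · rw [← h0]; positivity
  · have h7 := mul_le_mul_of_nonneg_left h3 h6
    refine le_of_mul_le_mul_right ?_ h0
    nlinarith

/-- The Rayleigh–Ritz residual of a unit vector in the column space is controlled by the sine of
the principal angle. -/
theorem residual_le (hkd : k ≤ d) (hU : Uᵀ * U = 1)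
    (h : ∀ z, botSq k (U *ᵥ z) ≤ τ ^ 2 * topSq k (U *ᵥ z)) {lam : Fin d → ℝ} {L : ℝ}
    (hL : ∀ i, |lam i| ≤ L) (z : Fin k → ℝ) (hz : z ⬝ᵥ z = 1) :
    (1 + τ ^ 2) * ((lam * (U *ᵥ z) - U *ᵥ (Uᵀ *ᵥ (lam * (U *ᵥ z)))) ⬝ᵥ
      (lam * (U *ᵥ z) - U *ᵥ (Uᵀ *ᵥ (lam * (U *ᵥ z))))) ≤ 4 * L ^ 2 * τ ^ 2 := by
  set w := U *ᵥ z with hw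
  -- Both halves leave a residual of squared norm at most `L² τ² / (1 + τ²)`: the top half is nearly
  -- preserved by the projection, the bottom half is itself small. Adding them costs a factor two,
  -- which gives the constant `4`.
  set m₁ : Fin d → ℝ := fun i => if i.val < k then lam i * w i else 0 with hm₁
  set m₂ : Fin d → ℝ := fun i => if i.val < k then 0 else lam i * w i with hm₂
  have hm : lam * w = m₁ + m₂ := by
    ext i
    by_cases hi : i.val < k <;> simp [hm₁, hm₂, hi]
  have hsum : topSq k w + botSq k w = 1 := by
    rw [topSq_add_botSq, hw, dotProduct_mulVec_self U hU, hz]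
  have hbot := h z
  rw [← hw] at hbot
  have ht0 := topSq_nonneg k w
  have hb0 := botSq_nonneg k w
  have hlam : ∀ i, lam i ^ 2 ≤ L ^ 2 := fun i => by
    rw [← sq_abs]
    exact pow_le_pow_left₀ (abs_nonneg _) (hL i) 2
  have e₁ : m₁ ⬝ᵥ m₁ ≤ L ^ 2 * topSq k w := by
    rw [topSq, Finset.sum_filter, Finset.mul_sum]
    refine Finset.sum_le_sum fun i _ => ?_
    by_cases hi : i.val < k
    · simp only [hm₁, hi, if_true]
      nlinarith [mul_le_mul_of_nonneg_right (hlam i) (sq_nonneg (w i))]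
    · simp [hm₁, hi]
  have e₂ : m₂ ⬝ᵥ m₂ ≤ L ^ 2 * botSq k w := by
    rw [botSq, Finset.sum_filter, Finset.mul_sum]
    refine Finset.sum_le_sum fun i _ => ?_
    by_cases hi : i.val < k
    · simp [hm₂, hi]
    · simp only [hm₂, hi, if_false, not_false_eq_true, if_true]
      nlinarith [mul_le_mul_of_nonneg_right (hlam i) (sq_nonneg (w i))]
  have hsplit : lam * w - U *ᵥ (Uᵀ *ᵥ (lam * w)) =
      (m₁ - U *ᵥ (Uᵀ *ᵥ m₁)) + (m₂ - U *ᵥ (Uᵀ *ᵥ m₂)) := by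
    rw [hm, Matrix.mulVec_add, Matrix.mulVec_add]
    abel
  have hp₁ := dotProduct_sub_proj U hU m₁
  have hp₂ := dotProduct_sub_proj U hU m₂
  have hadd := dotProduct_add_self_le (m₁ - U *ᵥ (Uᵀ *ᵥ m₁)) (m₂ - U *ᵥ (Uᵀ *ᵥ m₂))
  have htop := top_vector_le_proj hkd hU h m₁ fun i hi => by simp [hm₁, hi]
  have hq₂ := dotProduct_self_nonneg' (Uᵀ *ᵥ m₂)
  rw [← hsplit, hp₁, hp₂] at hadd
  set q₁ := (Uᵀ *ᵥ m₁) ⬝ᵥ (Uᵀ *ᵥ m₁)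
  set q₂ := (Uᵀ *ᵥ m₂) ⬝ᵥ (Uᵀ *ᵥ m₂)
  have f₁ : (1 + τ ^ 2) * (m₁ ⬝ᵥ m₁ - q₁) ≤ τ ^ 2 * L ^ 2 := by
    have : m₁ ⬝ᵥ m₁ ≤ L ^ 2 := e₁.trans (mul_le_of_le_one_right (sq_nonneg L) (by linarith))
    nlinarith [mul_le_mul_of_nonneg_left this (sq_nonneg τ)]
  have f₂ : (1 + τ ^ 2) * (m₂ ⬝ᵥ m₂) ≤ τ ^ 2 * L ^ 2 := by
    have : (1 + τ ^ 2) * botSq k w ≤ τ ^ 2 := by nlinarith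
    nlinarith [mul_le_mul_of_nonneg_left this (sq_nonneg L),
      mul_le_mul_of_nonneg_left e₂ (by positivity : 0 ≤ 1 + τ ^ 2)]
  have := mul_le_mul_of_nonneg_left hadd (by positivity : 0 ≤ 1 + τ ^ 2)
  have := mul_nonneg (by positivity : 0 ≤ 1 + τ ^ 2) hq₂
  nlinarith

/-- One approximate power step: the tangent of the principal angle shrinks by `1 - ρ / 2`. -/
theorem tangent_contraction (hkd : k ≤ d) (hU : Uᵀ * U = 1) (hτ : 0 ≤ τ)
    (h : ∀ z, botSq k (U *ᵥ z) ≤ τ ^ 2 * topSq k (U *ᵥ z)) {lam : Fin d → ℝ} {ℓ ρ γ s δ : ℝ}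
    (hℓ : 0 < ℓ) (hρ0 : 0 < ρ) (hρ1 : ρ ≤ 1) (hL : ∀ i, |lam i| ≤ γ * ℓ)
    (htop : ∀ i : Fin d, i.val < k → ℓ ≤ |lam i|)
    (hbot : ∀ i : Fin d, ¬ i.val < k → |lam i| ≤ (1 - ρ) * ℓ)
    (hs0 : 0 ≤ s) (hs1 : s ≤ 1) (hsτ : s * τ ≤ 1) (hδ0 : 0 ≤ δ)
    (hδ : 64 * k * γ ^ 2 * δ ≤ (ρ * s) ^ 2) (X : Matrix (Fin d) (Fin k) ℝ)
    (hX : ∑ i, ∑ j, (X - Matrix.diagonal lam * U) i j ^ 2 ≤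
      δ * ∑ i, ∑ j, (U * (Uᵀ * Matrix.diagonal lam * U) - Matrix.diagonal lam * U) i j ^ 2)
    (z : Fin k → ℝ) :
    botSq k (X *ᵥ z) ≤ ((1 - ρ / 2) * τ) ^ 2 * topSq k (X *ᵥ z) ∧ (X *ᵥ z = 0 → z = 0) := by
  set w := U *ᵥ z with hw
  set Ξ := X - Matrix.diagonal lam * U with hΞ
  have hdiag : ∀ y, (Matrix.diagonal lam * U) *ᵥ y = lam * (U *ᵥ y) := fun y => by
    rw [← Matrix.mulVec_mulVec]
    ext i
    simp [Matrix.mulVec_diagonal]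
  have hXz : ∀ i, (X *ᵥ z) i = lam i * w i + (Ξ *ᵥ z) i := fun i => by
    have : X = Matrix.diagonal lam * U + Ξ := by rw [hΞ]; abel
    rw [this, Matrix.add_mulVec, hdiag]
    rfl
  have hfro : (1 + τ ^ 2) * ∑ i, ∑ j, (U * (Uᵀ * Matrix.diagonal lam * U) -
      Matrix.diagonal lam * U) i j ^ 2 ≤ k * (4 * (γ * ℓ) ^ 2 * τ ^ 2) := by
    rw [Finset.sum_comm, Finset.mul_sum]
    calc _ ≤ ∑ _j : Fin k, 4 * (γ * ℓ) ^ 2 * τ ^ 2 := Finset.sum_le_sum fun j _ => by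
          -- Column `j` of the starting error is, up to sign, the residual of the `j`-th basis
          -- vector of the column space; summing over columns gives the factor `k`.
          have hr := residual_le hkd hU h hL (Pi.single j 1) (by simp)
          have hcol : ∀ i, (U * (Uᵀ * Matrix.diagonal lam * U) - Matrix.diagonal lam * U) i j =
              -(lam * (U *ᵥ Pi.single j 1) -
                U *ᵥ (Uᵀ *ᵥ (lam * (U *ᵥ Pi.single j 1)))) i := fun i => by
            rw [← hdiag, Matrix.mulVec_mulVec, Matrix.mulVec_mulVec, ← Matrix.sub_mulVec,
              Matrix.mulVec_single_one, Matrix.mul_assoc Uᵀ, Matrix.col_apply, ← Matrix.mul_assoc U,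
              Matrix.sub_apply, Matrix.sub_apply]
            ring
          refine le_of_eq_of_le ?_ hr
          congr 1
          refine Finset.sum_congr rfl fun i _ => ?_
          rw [hcol]; ring
      _ = k * (4 * (γ * ℓ) ^ 2 * τ ^ 2) := by simp
  set t := topSq k w with ht
  have ht0 : 0 ≤ t := topSq_nonneg k w
  have hbw : botSq k w ≤ τ ^ 2 * t := h z
  have hzz : z ⬝ᵥ z ≤ (1 + τ ^ 2) * t := by
    rw [← dotProduct_mulVec_self U hU, ← topSq_add_botSq k]
    linarith
  set e := ρ * s * ℓ * τ / 4 * Real.sqrt t with he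
  have hst := Real.sqrt_nonneg t
  have hst2 : Real.sqrt t ^ 2 = t := Real.sq_sqrt ht0
  have he0 : 0 ≤ e := by positivity
  -- The `1 + τ²` from `|z|²` cancels the one dividing the residual. With the `4` there, the `64` in
  -- `δ` leaves `1/16`, hence the `1/4` in `e`.
  have hnoise : (Ξ *ᵥ z) ⬝ᵥ (Ξ *ᵥ z) ≤ e ^ 2 := by
    set F := ∑ i, ∑ j, (U * (Uᵀ * Matrix.diagonal lam * U) - Matrix.diagonal lam * U) i j ^ 2
    have hF : 0 ≤ F := Finset.sum_nonneg fun i _ => Finset.sum_nonneg fun j _ => sq_nonneg _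
    calc (Ξ *ᵥ z) ⬝ᵥ (Ξ *ᵥ z) ≤ (∑ i, ∑ j, Ξ i j ^ 2) * (z ⬝ᵥ z) := mulVec_sq_le Ξ z
      _ ≤ (δ * F) * ((1 + τ ^ 2) * t) :=
          mul_le_mul hX hzz (dotProduct_self_nonneg' z) (mul_nonneg hδ0 hF)
      _ = δ * t * ((1 + τ ^ 2) * F) := by ring
      _ ≤ δ * t * (k * (4 * (γ * ℓ) ^ 2 * τ ^ 2)) :=
          mul_le_mul_of_nonneg_left hfro (mul_nonneg hδ0 ht0)
      _ = (64 * k * γ ^ 2 * δ) * (ℓ ^ 2 * τ ^ 2 * t / 16) := by ring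
      _ ≤ (ρ * s) ^ 2 * (ℓ ^ 2 * τ ^ 2 * t / 16) :=
          mul_le_mul_of_nonneg_right hδ (by positivity)
      _ = e ^ 2 := by rw [he, mul_pow _ (Real.sqrt t), hst2]; ring
  have hnt : topSq k (Ξ *ᵥ z) ≤ e ^ 2 := by
    linarith [topSq_add_botSq k (Ξ *ᵥ z), botSq_nonneg k (Ξ *ᵥ z)]
  have hnb : botSq k (Ξ *ᵥ z) ≤ e ^ 2 := by
    linarith [topSq_add_botSq k (Ξ *ᵥ z), topSq_nonneg k (Ξ *ᵥ z)]
  have hℓt : 0 ≤ ℓ * Real.sqrt t := mul_nonneg hℓ.le hst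
  -- The top coordinates need an error bound free of `τ`, from `s τ ≤ 1`; the bottom ones need one
  -- proportional to `τ`, from `s ≤ 1`.
  have hle : e ≤ ρ / 4 * (ℓ * Real.sqrt t) := by
    have : ρ / 4 * (s * τ) ≤ ρ / 4 * 1 := mul_le_mul_of_nonneg_left hsτ (by positivity)
    calc e = ρ / 4 * (s * τ) * (ℓ * Real.sqrt t) := by rw [he]; ring
      _ ≤ _ := mul_le_mul_of_nonneg_right (by linarith) hℓt
  have hle' : e ≤ ρ / 4 * τ * (ℓ * Real.sqrt t) := by
    have : ρ / 4 * τ * s ≤ ρ / 4 * τ * 1 := mul_le_mul_of_nonneg_left hs1 (by positivity)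
    calc e = ρ / 4 * τ * s * (ℓ * Real.sqrt t) := by rw [he]; ring
      _ ≤ _ := mul_le_mul_of_nonneg_right (by linarith) hℓt
  have hT : ((1 - ρ / 4) * (ℓ * Real.sqrt t)) ^ 2 ≤ topSq k (X *ᵥ z) := by
    have h1 : (ℓ * Real.sqrt t) ^ 2 ≤ ∑ i : Fin d with i.val < k, (lam i * w i) ^ 2 := by
      rw [mul_pow, hst2, ht, topSq, Finset.mul_sum]
      refine Finset.sum_le_sum fun i hi => ?_
      rw [mul_pow, ← sq_abs (lam i)]
      exact mul_le_mul_of_nonneg_right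
        (pow_le_pow_left₀ hℓ.le (htop i (Finset.mem_filter.1 hi).2) 2) (sq_nonneg _)
    have h2 := le_sum_add_sq _ he0 (by nlinarith) h1 hnt
    have h3 : topSq k (X *ᵥ z) =
        ∑ i : Fin d with i.val < k, (lam i * w i + (Ξ *ᵥ z) i) ^ 2 :=
      Finset.sum_congr rfl fun i _ => by rw [hXz]
    rw [h3]
    refine le_trans (pow_le_pow_left₀ (mul_nonneg (by linarith) hℓt) ?_ 2) h2
    linarith
  have hB : botSq k (X *ᵥ z) ≤ ((1 - 3 * ρ / 4) * τ * (ℓ * Real.sqrt t)) ^ 2 := by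
    have hp : 0 ≤ (1 - ρ) * ℓ := mul_nonneg (by linarith) hℓ.le
    have h1 : ∑ i : Fin d with ¬ i.val < k, (lam i * w i) ^ 2 ≤
        ((1 - ρ) * ℓ * τ * Real.sqrt t) ^ 2 := by
      calc _ ≤ ((1 - ρ) * ℓ) ^ 2 * botSq k w := by
            rw [botSq, Finset.mul_sum]
            refine Finset.sum_le_sum fun i hi => ?_
            rw [mul_pow, ← sq_abs (lam i)]
            exact mul_le_mul_of_nonneg_right
              (pow_le_pow_left₀ (abs_nonneg _) (hbot i (Finset.mem_filter.1 hi).2) 2) (sq_nonneg _)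
        _ ≤ ((1 - ρ) * ℓ) ^ 2 * (τ ^ 2 * t) := mul_le_mul_of_nonneg_left hbw (sq_nonneg _)
        _ = _ := by rw [mul_pow _ (Real.sqrt t), hst2]; ring
    have h2 := sum_add_sq_le _ (by positivity) he0 h1 hnb
    have h3 : botSq k (X *ᵥ z) =
        ∑ i : Fin d with ¬ i.val < k, (lam i * w i + (Ξ *ᵥ z) i) ^ 2 :=
      Finset.sum_congr rfl fun i _ => by rw [hXz]
    rw [h3]
    refine h2.trans (pow_le_pow_left₀ (by positivity) ?_ 2)
    linarith
  constructor
  · refine hB.trans (le_trans ?_ (mul_le_mul_of_nonneg_left hT (sq_nonneg _)))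
    rw [← mul_pow]
    refine pow_le_pow_left₀ (mul_nonneg (mul_nonneg (by linarith) hτ) hℓt) ?_ 2
    -- The error of `ρ/4` turns `1 - ρ` into `1 - 3ρ/4` below and `1` into `1 - ρ/4` above; their
    -- ratio is at most `1 - ρ/2`.
    have : 1 - 3 * ρ / 4 ≤ (1 - ρ / 2) * (1 - ρ / 4) := by nlinarith
    calc (1 - 3 * ρ / 4) * τ * (ℓ * Real.sqrt t) = (1 - 3 * ρ / 4) * (τ * (ℓ * Real.sqrt t)) := by
          ring
      _ ≤ (1 - ρ / 2) * (1 - ρ / 4) * (τ * (ℓ * Real.sqrt t)) :=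
          mul_le_mul_of_nonneg_right this (mul_nonneg hτ hℓt)
      _ = _ := by ring
  · intro h0
    have h1 : topSq k (X *ᵥ z) = 0 := by
      rw [h0]; exact Finset.sum_eq_zero fun i _ => by simp
    rw [h1] at hT
    have h2 : (1 - ρ / 4) * (ℓ * Real.sqrt t) = 0 :=
      pow_eq_zero_iff two_ne_zero |>.1 (le_antisymm hT (sq_nonneg _))
    have h3 : Real.sqrt t = 0 := by
      rcases mul_eq_zero.1 h2 with h | h
      · linarith
      · exact (mul_eq_zero.1 h).resolve_left hℓ.ne'
    rw [Real.sqrt_eq_zero ht0] at h3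
    rw [h3, mul_zero] at hzz
    exact dotProduct_self_eq_zero.1 (le_antisymm hzz (dotProduct_self_nonneg' z))

end Step

/-! ## The smallest singular value and the largest principal angle -/

/-- Expand `|Mz|²` in an eigenbasis of `MᵀM`: its eigenvalues are the squared singular values, and
the one at index `k - 1` is the least. -/
theorem sigmaMin_sq_mul_le {k : ℕ} (M : Matrix (Fin k) (Fin k) ℝ) (z : Fin k → ℝ) :
    sigmaMin M ^ 2 * (z ⬝ᵥ z) ≤ (M *ᵥ z) ⬝ᵥ (M *ᵥ z) := by
  rcases Nat.eq_zero_or_pos k with rfl | hk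
  · simp [dotProduct]
  set T := Matrix.toEuclideanLin M with hT
  have hn : Module.finrank ℝ (EuclideanSpace ℝ (Fin k)) = k := finrank_euclideanSpace_fin
  have hS := T.isSymmetric_adjoint_comp_self
  set b := hS.eigenvectorBasis hn
  set x : EuclideanSpace ℝ (Fin k) := WithLp.toLp 2 z with hx
  have hnorm : ‖T x‖ ^ 2 = (M *ᵥ z) ⬝ᵥ (M *ᵥ z) := by
    rw [EuclideanSpace.norm_sq_eq]
    simp [hT, hx, dotProduct, sq, Matrix.toLpLin_apply]
  have hxnorm : ‖x‖ ^ 2 = z ⬝ᵥ z := by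
    rw [EuclideanSpace.norm_sq_eq]
    simp [hx, dotProduct, sq]
  have hexp : ‖T x‖ ^ 2 = ∑ i, hS.eigenvalues hn i * b.repr x i ^ 2 := by
    have h1 : ‖T x‖ ^ 2 = inner ℝ x ((LinearMap.adjoint T ∘ₗ T) x) := by
      rw [LinearMap.comp_apply, LinearMap.adjoint_inner_right, real_inner_self_eq_norm_sq]
    rw [h1, ← b.repr.inner_map_map, PiLp.inner_apply]
    refine Finset.sum_congr rfl fun i _ => ?_
    rw [hS.eigenvectorBasis_apply_self_apply hn]
    simp only [RCLike.inner_apply, conj_trivial, RCLike.ofReal_real_eq_id, id]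
    ring
  have hxexp : ‖x‖ ^ 2 = ∑ i, b.repr x i ^ 2 := by
    rw [← b.repr.norm_map, EuclideanSpace.norm_sq_eq]
    simp
  rw [← hnorm, ← hxnorm, hexp, hxexp, Finset.mul_sum]
  refine Finset.sum_le_sum fun i _ => mul_le_mul_of_nonneg_right ?_ (sq_nonneg _)
  have h1 : sigmaMin M ≤ T.singularValues i :=
    T.singularValues_antitone (by have := i.2; omega)
  have h2 : 0 ≤ sigmaMin M := T.singularValues_nonneg _
  calc sigmaMin M ^ 2 ≤ T.singularValues i ^ 2 := pow_le_pow_left₀ h2 h1 2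
    _ = _ := T.sq_singularValues_fin hn i

/-- The last eigenvector of `MᵀM` attains the minimum. -/
theorem exists_sigmaMin_sq_eq {k : ℕ} (hk : 0 < k) (M : Matrix (Fin k) (Fin k) ℝ) :
    ∃ z : Fin k → ℝ, z ⬝ᵥ z = 1 ∧ (M *ᵥ z) ⬝ᵥ (M *ᵥ z) = sigmaMin M ^ 2 := by
  set T := Matrix.toEuclideanLin M with hT
  have hn : Module.finrank ℝ (EuclideanSpace ℝ (Fin k)) = k := finrank_euclideanSpace_fin
  have hS := T.isSymmetric_adjoint_comp_self
  have hk1 : k - 1 < k := by omega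
  set x := hS.eigenvectorBasis hn ⟨k - 1, hk1⟩ with hx
  have hx1 : ‖x‖ = 1 := (hS.eigenvectorBasis hn).orthonormal.1 _
  refine ⟨x.ofLp, ?_, ?_⟩
  · have : ‖x‖ ^ 2 = x.ofLp ⬝ᵥ x.ofLp := by
      rw [EuclideanSpace.norm_sq_eq]
      simp [dotProduct, sq]
    rw [← this, hx1, one_pow]
  · have h0 : ‖T x‖ ^ 2 = (M *ᵥ x.ofLp) ⬝ᵥ (M *ᵥ x.ofLp) := by
      rw [EuclideanSpace.norm_sq_eq]
      simp [hT, dotProduct, sq, Matrix.toLpLin_apply]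
    have h1 : ‖T x‖ ^ 2 = inner ℝ x ((LinearMap.adjoint T ∘ₗ T) x) := by
      rw [LinearMap.comp_apply, LinearMap.adjoint_inner_right, real_inner_self_eq_norm_sq]
    rw [← h0, h1, hx, hS.apply_eigenvectorBasis hn, ← hx, inner_smul_right,
      real_inner_self_eq_norm_sq, hx1, one_pow, mul_one]
    exact (T.sq_singularValues_of_lt hn hk1).symm

theorem sigmaMin_nonneg {k : ℕ} (M : Matrix (Fin k) (Fin k) ℝ) : 0 ≤ sigmaMin M :=
  LinearMap.singularValues_nonneg _ _

theorem cos_arccos_sigmaMin {k : ℕ} {M : Matrix (Fin k) (Fin k) ℝ} (h : sigmaMin M ≤ 1) :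
    Real.cos (Real.arccos (sigmaMin M)) = sigmaMin M :=
  Real.cos_arccos (by linarith [sigmaMin_nonneg M]) h

/-- A bound on the tangent of the principal angle bounds its sine. -/
theorem sin_arccos_sigmaMin_le {k : ℕ} (hk : 0 < k) {M : Matrix (Fin k) (Fin k) ℝ} {τ : ℝ}
    (hτ : 0 ≤ τ) (h : ∀ z, z ⬝ᵥ z ≤ (1 + τ ^ 2) * ((M *ᵥ z) ⬝ᵥ (M *ᵥ z))) :
    Real.sin (Real.arccos (sigmaMin M)) ≤ τ := by
  -- At a minimizing unit vector the hypothesis reads `1 ≤ (1 + τ²) σ²`, so `1 - σ² ≤ τ² / (1 + τ²)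
  -- ≤ τ²`.
  obtain ⟨z, hz, hz'⟩ := exists_sigmaMin_sq_eq hk M
  have h1 := h z
  rw [hz, hz'] at h1
  rw [Real.sin_arccos]
  refine Real.sqrt_le_iff.2 ⟨hτ, ?_⟩
  by_contra hlt
  push Not at hlt
  nlinarith [sq_nonneg τ, sq_nonneg (sigmaMin M)]

/-! ## Eigencoordinates of the pencil -/

/-- The square matrix of all generalized eigenvectors. -/
def eigMatrix {d : ℕ} (v : Fin d → Fin d → ℝ) : Matrix (Fin d) (Fin d) ℝ :=
  Matrix.of fun i j => v j i

section Coordinates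

variable {d k : ℕ} {A B : Matrix (Fin d) (Fin d) ℝ} {lam : Fin d → ℝ} {v : Fin d → Fin d → ℝ}

theorem eigMatrix_orthonormal (hv : IsGeneralizedEigensystem A B lam v) :
    (eigMatrix v)ᵀ * B * eigMatrix v = 1 := by
  ext i j
  rw [transpose_mul_mul_apply, Matrix.one_apply]
  exact hv.orthonormal i j

/-- One-sided inverses of square matrices are two-sided. Inserting this product between factors is
how expressions are moved to eigencoordinates. -/
theorem mul_eigMatrix_mul_transpose (hv : IsGeneralizedEigensystem A B lam v) :
    B * (eigMatrix v * (eigMatrix v)ᵀ) = 1 := by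
  have h : eigMatrix v * ((eigMatrix v)ᵀ * B) = 1 :=
    mul_eq_one_comm.1 (eigMatrix_orthonormal hv)
  rw [← Matrix.mul_assoc] at h
  exact mul_eq_one_comm.1 h

theorem mul_eigMatrix (hv : IsGeneralizedEigensystem A B lam v) :
    A * eigMatrix v = B * eigMatrix v * Matrix.diagonal lam := by
  ext i j
  rw [Matrix.mul_diagonal]
  have := congrFun (hv.eigen j) i
  rw [Pi.smul_apply, smul_eq_mul] at this
  rw [mul_comm]
  exact this

theorem eigMatrix_transpose_mul (hA : A.IsSymm) (hB : Bᵀ = B)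
    (hv : IsGeneralizedEigensystem A B lam v) :
    (eigMatrix v)ᵀ * A = Matrix.diagonal lam * (eigMatrix v)ᵀ * B := by
  have := congrArg Matrix.transpose (mul_eigMatrix hv)
  simpa [Matrix.transpose_mul, hA.eq, hB, Matrix.mul_assoc] using this

/-- The coordinates of the columns of `X` in the generalized eigenbasis. -/
def eigCoords (B : Matrix (Fin d) (Fin d) ℝ) (v : Fin d → Fin d → ℝ)
    (X : Matrix (Fin d) (Fin k) ℝ) : Matrix (Fin d) (Fin k) ℝ :=
  (eigMatrix v)ᵀ * B * X

theorem transpose_mul_mul_eq (hB : Bᵀ = B) (hv : IsGeneralizedEigensystem A B lam v)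
    (X Y : Matrix (Fin d) (Fin k) ℝ) :
    Xᵀ * B * Y = (eigCoords B v X)ᵀ * eigCoords B v Y := by
  have := mul_eigMatrix_mul_transpose hv
  calc Xᵀ * B * Y = Xᵀ * (B * (eigMatrix v * (eigMatrix v)ᵀ)) * B * Y := by
        rw [this, Matrix.mul_one]
    _ = _ := by simp [eigCoords, Matrix.transpose_mul, hB, Matrix.mul_assoc]

theorem matNormSqB_eq (hB : Bᵀ = B) (hv : IsGeneralizedEigensystem A B lam v)
    (X : Matrix (Fin d) (Fin k) ℝ) : matNormSqB B X = ∑ i, ∑ j, eigCoords B v X i j ^ 2 := by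
  rw [matNormSqB, transpose_mul_mul_eq hB hv, Finset.sum_comm]
  simp [Matrix.trace, Matrix.mul_apply, sq]

/-- In eigencoordinates the exact power step is a rescaling. -/
theorem eigCoords_inv_mul (hA : A.IsSymm) (hB : B.PosDef)
    (hv : IsGeneralizedEigensystem A B lam v) (W : Matrix (Fin d) (Fin k) ℝ) :
    eigCoords B v (B⁻¹ * (A * W)) = Matrix.diagonal lam * eigCoords B v W := by
  have hBt : Bᵀ = B := by simpa [Matrix.IsHermitian] using hB.isHermitian
  have hu : IsUnit B.det := (Matrix.isUnit_iff_isUnit_det B).1 hB.isUnit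
  rw [eigCoords, Matrix.mul_assoc, Matrix.mul_nonsing_inv_cancel_left _ _ hu, ← Matrix.mul_assoc,
    eigMatrix_transpose_mul hA hBt hv, eigCoords]
  simp only [Matrix.mul_assoc]

theorem transpose_mul_mul_eq_diagonal (hA : A.IsSymm) (hB : Bᵀ = B)
    (hv : IsGeneralizedEigensystem A B lam v) (W : Matrix (Fin d) (Fin k) ℝ) :
    Wᵀ * (A * W) = (eigCoords B v W)ᵀ * Matrix.diagonal lam * eigCoords B v W := by
  have h := mul_eigMatrix_mul_transpose hv
  calc Wᵀ * (A * W) = Wᵀ * (B * (eigMatrix v * (eigMatrix v)ᵀ)) * (A * W) := by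
        rw [h, Matrix.mul_one]
    _ = Wᵀ * B * eigMatrix v * ((eigMatrix v)ᵀ * A) * W := by simp only [Matrix.mul_assoc]
    _ = _ := by
        rw [eigMatrix_transpose_mul hA hB hv]
        simp [eigCoords, Matrix.transpose_mul, hB, Matrix.mul_assoc]

theorem eigCoords_sub (X Y : Matrix (Fin d) (Fin k) ℝ) :
    eigCoords B v (X - Y) = eigCoords B v X - eigCoords B v Y := Matrix.mul_sub _ _ _

theorem eigCoords_mul {m : ℕ} (X : Matrix (Fin d) (Fin k) ℝ) (Y : Matrix (Fin k) (Fin m) ℝ) :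
    eigCoords B v (X * Y) = eigCoords B v X * Y := (Matrix.mul_assoc _ _ _).symm

/-- The link to the principal angle: the first `k` rows of the coordinate matrix are `Vᵀ B W`. -/
theorem topSq_eigCoords (hkd : k ≤ d) (W : Matrix (Fin d) (Fin k) ℝ) (z : Fin k → ℝ) :
    topSq k (eigCoords B v W *ᵥ z) =
      (((topMatrix hkd v)ᵀ * B * W) *ᵥ z) ⬝ᵥ (((topMatrix hkd v)ᵀ * B * W) *ᵥ z) := by
  rw [topSq, sum_lt_eq_sum_castLE hkd]
  exact Finset.sum_congr rfl fun i _ => sq _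

theorem eigCoords_mulVec_eq_zero {W : Matrix (Fin d) (Fin k) ℝ} {z : Fin k → ℝ} (h : W *ᵥ z = 0) :
    eigCoords B v W *ᵥ z = 0 := by
  rw [eigCoords, ← Matrix.mulVec_mulVec, h, Matrix.mulVec_zero]

/-- `tan θ(W, V) ≤ τ` for a `B`-orthonormal `W` and the top eigenspace `V`. -/
structure TangentLE (B : Matrix (Fin d) (Fin d) ℝ) (v : Fin d → Fin d → ℝ) (τ : ℝ)
    (W : Matrix (Fin d) (Fin k) ℝ) : Prop where
  orthonormal : Wᵀ * B * W = 1
  botSq_le : ∀ z, botSq k (eigCoords B v W *ᵥ z) ≤ τ ^ 2 * topSq k (eigCoords B v W *ᵥ z)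

theorem TangentLE.achievesError (hk : 0 < k) (hkd : k ≤ d) (hB : Bᵀ = B)
    (hv : IsGeneralizedEigensystem A B lam v) {W : Matrix (Fin d) (Fin k) ℝ} {τ : ℝ} (hτ : 0 ≤ τ)
    (h : TangentLE B v τ W) : AchievesError B (topMatrix hkd v) τ W := by
  refine ⟨h.orthonormal, sin_arccos_sigmaMin_le hk hτ fun z => ?_⟩
  have hU := h.orthonormal
  rw [transpose_mul_mul_eq hB hv] at hU
  rw [← topSq_eigCoords, ← dotProduct_mulVec_self _ hU, ← topSq_add_botSq k]
  linarith [h.botSq_le z]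

/-- The positive cosine serves twice: it excludes zero columns, which would force `sigmaMin = 0`,
and it bounds the top coordinates below by `cos² θ |z|²`. -/
theorem tangentLE_gramSchmidt (hkd : k ≤ d) (hB : B.PosDef)
    (hv : IsGeneralizedEigensystem A B lam v) (X : Matrix (Fin d) (Fin k) ℝ)
    (hpos : 0 < Real.cos (angle B (gramSchmidt B X).val (topMatrix hkd v))) :
    TangentLE B v (Real.tan (angle B (gramSchmidt B X).val (topMatrix hkd v)))
      (gramSchmidt B X).val := by
  have hBt : Bᵀ = B := by simpa [Matrix.IsHermitian] using hB.isHermitian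
  set W := (gramSchmidt B X).val with hW
  set M := (topMatrix hkd v)ᵀ * B * W with hM
  set θ := angle B W (topMatrix hkd v) with hθ
  have hσ : 0 < sigmaMin M := by
    rw [hθ, angle] at hpos
    by_contra h
    rw [le_antisymm (not_lt.1 h) (sigmaMin_nonneg M), Real.arccos_zero, Real.cos_pi_div_two]
      at hpos
    exact lt_irrefl _ hpos
  have hon : Wᵀ * B * W = 1 := gramSchmidt_orthonormal_of_col_ne_zero hB X fun j hj => by
    have h1 := sigmaMin_sq_mul_le M (Pi.single j 1)
    rw [hM, ← topSq_eigCoords, eigCoords_mulVec_eq_zero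
      (by rw [Matrix.mulVec_single_one]; exact hj)] at h1
    have h2 : topSq k (0 : Fin d → ℝ) = 0 := Finset.sum_eq_zero fun i _ => by simp
    rw [h2] at h1
    simp only [dotProduct_single, mul_one, Pi.single_eq_same] at h1
    exact absurd h1 (not_le.2 (pow_pos hσ 2))
  refine ⟨hon, fun z => ?_⟩
  have hU := hon
  rw [transpose_mul_mul_eq hBt hv] at hU
  set U := eigCoords B v W with hUdef
  have hle : ∀ z, Real.cos θ ^ 2 * (z ⬝ᵥ z) ≤ topSq k (U *ᵥ z) := fun z => by
    have h1 := sigmaMin_sq_mul_le M z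
    rw [hM, ← topSq_eigCoords] at h1
    refine le_trans (mul_le_mul_of_nonneg_right ?_ (dotProduct_self_nonneg' z)) h1
    refine pow_le_pow_left₀ hpos.le ?_ 2
    -- If `sigmaMin M` exceeded one, `arccos` would truncate it; `cos ≤ 1` settles that case without
    -- ruling it out.
    rcases le_total (sigmaMin M) 1 with h | h
    · exact (cos_arccos_sigmaMin h).le
    · exact (Real.cos_le_one _).trans h
  have h1 := hle z
  rw [← dotProduct_mulVec_self U hU, ← topSq_add_botSq k] at h1
  have h2 := Real.sin_sq_add_cos_sq θ
  rw [Real.tan_eq_sin_div_cos, div_pow, div_mul_eq_mul_div, le_div_iff₀ (pow_pos hpos 2)]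
  rw [show Real.sin θ ^ 2 = 1 - Real.cos θ ^ 2 by linarith]
  linarith

/-- `tangent_contraction` carried back from eigencoordinates; its injectivity clause is what makes
Gram–Schmidt succeed. -/
theorem TangentLE.step (hkd : k ≤ d) (hA : A.IsSymm) (hB : B.PosDef)
    (hv : IsGeneralizedEigensystem A B lam v) {τ : ℝ} (hτ : 0 ≤ τ) {W : Matrix (Fin d) (Fin k) ℝ}
    (h : TangentLE B v τ W) {ℓ ρ γ s δ : ℝ}
    (hℓ : 0 < ℓ) (hρ0 : 0 < ρ) (hρ1 : ρ ≤ 1) (hL : ∀ i, |lam i| ≤ γ * ℓ)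
    (htop : ∀ i : Fin d, i.val < k → ℓ ≤ |lam i|)
    (hbot : ∀ i : Fin d, ¬ i.val < k → |lam i| ≤ (1 - ρ) * ℓ)
    (hs0 : 0 ≤ s) (hs1 : s ≤ 1) (hsτ : s * τ ≤ 1) (hδ0 : 0 ≤ δ)
    (hδ : 64 * k * γ ^ 2 * δ ≤ (ρ * s) ^ 2) (X : Matrix (Fin d) (Fin k) ℝ)
    (hX : matNormSqB B (X - B⁻¹ * (A * W)) ≤
      δ * matNormSqB B (W * (Wᵀ * (A * W)) - B⁻¹ * (A * W))) :
    TangentLE B v ((1 - ρ / 2) * τ) (gramSchmidt B X).val := by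
  have hBt : Bᵀ = B := by simpa [Matrix.IsHermitian] using hB.isHermitian
  have hU := h.orthonormal
  rw [transpose_mul_mul_eq hBt hv] at hU
  rw [matNormSqB_eq hBt hv, matNormSqB_eq hBt hv, eigCoords_sub, eigCoords_sub,
    eigCoords_inv_mul hA hB hv, eigCoords_mul, transpose_mul_mul_eq_diagonal hA hBt hv] at hX
  have key := tangent_contraction hkd hU hτ h.botSq_le hℓ hρ0 hρ1 hL htop hbot hs0 hs1 hsτ hδ0 hδ
    (eigCoords B v X) hX
  refine ⟨gramSchmidt_orthonormal hB X fun z hz =>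
    (key z).2 (eigCoords_mulVec_eq_zero hz), fun z => ?_⟩
  obtain ⟨y, hy⟩ := gramSchmidt_mulVec hB X z
  have : eigCoords B v (gramSchmidt B X).val *ᵥ z = eigCoords B v X *ᵥ y := by
    rw [eigCoords, eigCoords, ← Matrix.mulVec_mulVec, hy, Matrix.mulVec_mulVec]
  rw [this]
  exact (key y).1

end Coordinates

/-! ## Convergence of accelerated gradient descent -/

/-- One step of accelerated gradient descent on a one-dimensional quadratic with curvature `μ`
contracts the energy `μ y² + α z²`, where `z = x + s (x - y)` and `s² = β / α`. -/
theorem agd_energy_step {α μ s x y x' y' : ℝ} (hα : 0 < α) (hs : 1 ≤ s) (hμα : α ≤ μ)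
    (hμβ : μ ≤ s ^ 2 * α) (hy : y' = x - 1 / (s ^ 2 * α) * (μ * x))
    (hx : x' = y' + (s - 1) / (s + 1) * (y' - y)) :
    μ * y' ^ 2 + α * (x' + s * (x' - y')) ^ 2 ≤
      (1 - 1 / s) * (μ * y ^ 2 + α * (x + s * (x - y)) ^ 2) := by
  have hs0 : 0 < s := by linarith
  -- Here `p = μ / β`, so the gradient step multiplies `x` by `1 - p`.
  obtain ⟨p, rfl⟩ : ∃ p, μ = p * s ^ 2 * α := ⟨μ / (s ^ 2 * α), by field_simp⟩
  have hp1 : p ≤ 1 := by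
    have : 0 < s ^ 2 * α := by positivity
    nlinarith
  have hp0 : 1 ≤ p * s ^ 2 := by nlinarith
  have hp : 0 ≤ p := by
    by_contra h
    nlinarith [sq_nonneg s]
  have hy' : y' = (1 - p) * x := by rw [hy]; field_simp
  have hz : x' + s * (x' - y') = s * y' - (s - 1) * y := by
    have : s + 1 ≠ 0 := by linarith
    rw [hx]; field_simp; ring
  have hD : 0 ≤ (p * s - 1 / s) + s ^ 2 * p ^ 2 * (1 - p) := by
    have h1 : 0 ≤ p * s - 1 / s := by
      rw [sub_nonneg, div_le_iff₀ hs0]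
      linarith
    have h2 : 0 ≤ s ^ 2 * p ^ 2 * (1 - p) := mul_nonneg (by positivity) (by linarith)
    linarith
  -- The energy gap is an explicit sum of nonnegative terms; `p s ≥ 1/s` is the strong convexity `μ
  -- ≥ α`.
  have key : (1 - 1 / s) * (p * s ^ 2 * α * y ^ 2 + α * (x + s * (x - y)) ^ 2) -
      (p * s ^ 2 * α * y' ^ 2 + α * (x' + s * (x' - y')) ^ 2) =
      α * ((s - 1) * (1 + p * s) * (y - x) ^ 2 +
        ((p * s - 1 / s) + s ^ 2 * p ^ 2 * (1 - p)) * x ^ 2) := by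
    rw [hz, hy']; field_simp; ring
  have h1 : 0 ≤ (s - 1) * (1 + p * s) * (y - x) ^ 2 :=
    mul_nonneg (mul_nonneg (by linarith) (by positivity)) (sq_nonneg _)
  have := mul_nonneg hα.le (add_nonneg h1 (mul_nonneg hD (sq_nonneg x)))
  linarith

section Spectral

variable {d : ℕ} {B : Matrix (Fin d) (Fin d) ℝ}

/-- The coordinates of a vector in the orthonormal eigenbasis of `B`. -/
noncomputable def specCoord (hB : B.IsHermitian) (u : Fin d → ℝ) (i : Fin d) : ℝ :=
  (hB.eigenvectorBasis i).ofLp ⬝ᵥ u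

theorem specCoord_mulVec (hB : B.IsHermitian) (u : Fin d → ℝ) (i : Fin d) :
    specCoord hB (B *ᵥ u) i = hB.eigenvalues i * specCoord hB u i := by
  have hBt : Bᵀ = B := by simpa [Matrix.IsHermitian] using hB
  rw [specCoord, Matrix.dotProduct_mulVec, ← Matrix.mulVec_transpose, hBt,
    hB.mulVec_eigenvectorBasis, smul_dotProduct]
  rfl

theorem specCoord_sub (hB : B.IsHermitian) (u w : Fin d → ℝ) (i : Fin d) :
    specCoord hB (u - w) i = specCoord hB u i - specCoord hB w i := dotProduct_sub _ _ _

theorem specCoord_add (hB : B.IsHermitian) (u w : Fin d → ℝ) (i : Fin d) :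
    specCoord hB (u + w) i = specCoord hB u i + specCoord hB w i := dotProduct_add _ _ _

theorem specCoord_smul (hB : B.IsHermitian) (c : ℝ) (u : Fin d → ℝ) (i : Fin d) :
    specCoord hB (c • u) i = c * specCoord hB u i := dotProduct_smul _ _ _

theorem dotProduct_eq_sum_specCoord (hB : B.IsHermitian) (u w : Fin d → ℝ) :
    u ⬝ᵥ w = ∑ i, specCoord hB u i * specCoord hB w i := by
  have h := hB.eigenvectorBasis.sum_inner_mul_inner (WithLp.toLp 2 u) (WithLp.toLp 2 w)
  have e1 : inner ℝ (WithLp.toLp 2 u : EuclideanSpace ℝ (Fin d)) (WithLp.toLp 2 w) = u ⬝ᵥ w := by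
    rw [EuclideanSpace.inner_eq_star_dotProduct]
    simp [dotProduct_comm]
  rw [← e1, ← h]
  refine Finset.sum_congr rfl fun i _ => ?_
  rw [EuclideanSpace.inner_eq_star_dotProduct, EuclideanSpace.inner_eq_star_dotProduct]
  simp [specCoord, dotProduct_comm]

theorem normSqB_eq_sum_specCoord (hB : B.IsHermitian) (u : Fin d → ℝ) :
    normSqB B u = ∑ i, hB.eigenvalues i * specCoord hB u i ^ 2 := by
  rw [normSqB, dotProduct_eq_sum_specCoord hB]
  refine Finset.sum_congr rfl fun i _ => ?_
  rw [specCoord_mulVec]; ring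

theorem eigenvalues_le_eigMax (hB : B.IsHermitian) (i : Fin d) : hB.eigenvalues i ≤ eigMax B :=
  le_csSup Matrix.finite_real_spectrum.bddAbove (hB.eigenvalues_mem_spectrum_real i)

theorem eigMin_le_eigenvalues (hB : B.IsHermitian) (i : Fin d) : eigMin B ≤ hB.eigenvalues i :=
  csInf_le Matrix.finite_real_spectrum.bddBelow (hB.eigenvalues_mem_spectrum_real i)

/-- A finite nonempty spectrum attains its infimum; for `d = 0` the infimum would be zero by
convention. -/
theorem eigMin_pos (hd : 0 < d) (hB : B.PosDef) : 0 < eigMin B := by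
  have hne : (spectrum ℝ B).Nonempty :=
    ⟨_, hB.isHermitian.eigenvalues_mem_spectrum_real ⟨0, hd⟩⟩
  have hmem : eigMin B ∈ spectrum ℝ B := hne.csInf_mem Matrix.finite_real_spectrum
  rw [hB.isHermitian.spectrum_real_eq_range_eigenvalues] at hmem
  obtain ⟨i, hi⟩ := hmem
  rw [← hi]
  exact hB.eigenvalues_pos i

theorem one_le_cond (hd : 0 < d) (hB : B.PosDef) : 1 ≤ cond B := by
  rw [cond, one_le_div (eigMin_pos hd hB)]
  exact (eigMin_le_eigenvalues hB.isHermitian ⟨0, hd⟩).trans (eigenvalues_le_eigMax _ _)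

end Spectral

/-- The iteration is linear around `B⁻¹ b` and decouples in an eigenbasis of `B`, so the
one-dimensional energies can be summed. -/
theorem agd_val_normSqB_le {d : ℕ} (hd : 0 < d) {B : Matrix (Fin d) (Fin d) ℝ} (hB : B.PosDef)
    (N : ℕ) (b u₀ : Fin d → ℝ) :
    normSqB B ((agd B (eigMin B) (eigMax B) N b u₀).val - B⁻¹ *ᵥ b) ≤
      2 * (1 - 1 / Real.sqrt (cond B)) ^ N * normSqB B (u₀ - B⁻¹ *ᵥ b) := by
  have hH := hB.isHermitian
  have hα := eigMin_pos hd hB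
  have hκ := one_le_cond hd hB
  set α := eigMin B with hαdef
  set s := Real.sqrt (cond B) with hs
  have hs1 : 1 ≤ s := Real.one_le_sqrt.2 hκ
  have hs2 : s ^ 2 = cond B := Real.sq_sqrt (by linarith)
  have hβ : eigMax B = s ^ 2 * α := by rw [hs2, cond, ← hαdef]; field_simp
  set x₀ := B⁻¹ *ᵥ b with hx₀
  have hu : IsUnit B.det := (Matrix.isUnit_iff_isUnit_det B).1 hB.isUnit
  have hBx₀ : B *ᵥ x₀ = b := by
    rw [hx₀, Matrix.mulVec_mulVec, Matrix.mul_nonsing_inv B hu, Matrix.one_mulVec]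
  set c := specCoord hH with hc
  set E : (Fin d → ℝ) × (Fin d → ℝ) → ℝ := fun st => ∑ i, (hH.eigenvalues i * c (st.2 - x₀) i ^ 2 +
    α * (c (st.1 - x₀) i + s * (c (st.1 - x₀) i - c (st.2 - x₀) i)) ^ 2) with hE
  have hr0 : 0 ≤ 1 - 1 / s := by
    rw [sub_nonneg, div_le_one (by linarith)]
    exact hs1
  have hinv : E (loop (fun _ (st : (Fin d → ℝ) × (Fin d → ℝ)) => do
      let Bx ← sparseMulVec B st.1
      let y ← vec fun i => do
        let g ← sub (Bx i) (b i)
        let step ← mul (1 / eigMax B) g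
        sub (st.1 i) step
      let x ← vec fun i => do
        let diff ← sub (y i) (st.2 i)
        let mom ← mul ((s - 1) / (s + 1)) diff
        add (y i) mom
      pure (x, y)) N (u₀, u₀)).val ≤ (1 - 1 / s) ^ N * E (u₀, u₀) := by
    refine loop_invariant (fun n st => E st ≤ (1 - 1 / s) ^ n * E (u₀, u₀)) (by simp)
      fun n _ st ih => ?_
    rw [pow_succ']
    refine le_trans ?_ ((mul_le_mul_of_nonneg_left ih hr0).trans_eq (mul_assoc _ _ _).symm)
    simp only [bind_val, pure_val, vec_val, sub_val, mul_val, add_val, sparseMulVec_val]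
    rw [hE, Finset.mul_sum]
    refine Finset.sum_le_sum fun i _ => ?_
    set y : Fin d → ℝ := fun i => st.1 i - 1 / eigMax B * ((B *ᵥ st.1) i - b i) with hy
    have hy1 : y - x₀ = (st.1 - x₀) - (1 / eigMax B) • (B *ᵥ (st.1 - x₀)) := by
      rw [Matrix.mulVec_sub, hBx₀]
      ext j
      simp only [hy, Pi.sub_apply, Pi.smul_apply, smul_eq_mul]
      ring
    have hx1 : (fun i => y i + (s - 1) / (s + 1) * (y i - st.2 i)) - x₀ =
        (y - x₀) + ((s - 1) / (s + 1)) • ((y - x₀) - (st.2 - x₀)) := by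
      ext j
      simp only [Pi.sub_apply, Pi.add_apply, Pi.smul_apply, smul_eq_mul]
      ring
    refine agd_energy_step hα hs1 (eigMin_le_eigenvalues hH i)
      ((eigenvalues_le_eigMax hH i).trans_eq hβ) ?_ ?_
    · rw [hy1, hc, specCoord_sub, specCoord_smul, specCoord_mulVec, hβ]
    · rw [hx1, hc, specCoord_add, specCoord_smul, specCoord_sub hH (y - x₀)]
  -- At the start `x = y`, so each term is `(μ + α) c² ≤ 2 μ c²`.
  have hE0 : E (u₀, u₀) ≤ 2 * normSqB B (u₀ - x₀) := by
    rw [normSqB_eq_sum_specCoord hH, Finset.mul_sum]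
    refine Finset.sum_le_sum fun i _ => ?_
    have := mul_le_mul_of_nonneg_right (eigMin_le_eigenvalues hH i) (sq_nonneg (c (u₀ - x₀) i))
    simp only [sub_self, mul_zero, add_zero]
    linarith
  have hEN : ∀ st, normSqB B (st.2 - x₀) ≤ E st := fun st => by
    rw [normSqB_eq_sum_specCoord hH]
    refine Finset.sum_le_sum fun i _ => le_add_of_nonneg_right ?_
    positivity
  refine (hEN _).trans (hinv.trans ?_)
  have := mul_le_mul_of_nonneg_left hE0 (pow_nonneg hr0 N)
  linarith

theorem agdSolver_isSolver {d : ℕ} (hd : 0 < d) {B : Matrix (Fin d) (Fin d) ℝ} (hB : B.PosDef) :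
    IsSolver B (agdSolver B)
      fun δ => 45 * (nnz B * (Real.sqrt (cond B) * Real.log (2 / δ))) := by
  intro δ hδ0 hδ1 b u₀
  have hκ := one_le_cond hd hB
  set s := Real.sqrt (cond B) with hs
  have hs1 : 1 ≤ s := Real.one_le_sqrt.2 hκ
  have hlog : Real.log 2 ≤ Real.log (2 / δ) :=
    Real.log_le_log two_pos (by rw [le_div_iff₀ hδ0]; linarith)
  have hlog2 := Real.log_two_gt_d9
  set N := ⌈s * Real.log (2 / δ)⌉₊ with hN
  have hsl : 1 / 2 ≤ s * Real.log (2 / δ) := by nlinarith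
  constructor
  · refine (agd_val_normSqB_le hd hB N b u₀).trans
      (mul_le_mul_of_nonneg_right ?_ ?_)
    · rw [← hs]
      have h0 : 0 ≤ 1 - 1 / s := by
        rw [sub_nonneg, div_le_one (by linarith)]
        exact hs1
      -- The right side is `δ / 2`, which compensates the factor two in the initial energy.
      have h1 : (1 - 1 / s) ^ N ≤ Real.exp (-Real.log (2 / δ)) := by
        calc (1 - 1 / s) ^ N ≤ Real.exp (-(1 / s)) ^ N :=
              pow_le_pow_left₀ h0 (by linarith [Real.add_one_le_exp (-(1 / s))]) N
          _ = Real.exp (-(N / s)) := by rw [← Real.exp_nat_mul]; congr 1; ring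
          _ ≤ _ := by
            rw [Real.exp_le_exp, neg_le_neg_iff, le_div_iff₀ (by linarith), mul_comm]
            exact Nat.le_ceil _
      rw [Real.exp_neg, Real.exp_log (by positivity), inv_div] at h1
      linarith
    · rcases eq_or_ne (u₀ - B⁻¹ *ᵥ b) 0 with h | h
      · simp [h, normSqB]
      · exact (normSqB_pos hB h).le
  · have h1 := agd_time B (eigMin B) (eigMax B) N b u₀
    -- Rounding up is absorbed since `s log (2 / δ) ≥ 1/2`. Then `45 = 3 · 11 + 12`, the `12` paying
    -- for the six initial operations.
    have h2 : (N : ℝ) ≤ 3 * (s * Real.log (2 / δ)) := by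
      have := Nat.ceil_lt_add_one (by linarith : 0 ≤ s * Real.log (2 / δ))
      linarith
    have h3 : (d : ℝ) ≤ nnz B := by exact_mod_cast nnz_ge_of_posDef hB
    have h4 : (1 : ℝ) ≤ d := by exact_mod_cast hd
    have h5 : ((agdSolver B δ b u₀).time : ℝ) ≤ 6 + N * (2 * nnz B + 9 * d) := by
      exact_mod_cast h1
    have h6 : (N : ℝ) * (2 * nnz B + 9 * d) ≤ 3 * (s * Real.log (2 / δ)) * (11 * nnz B) :=
      mul_le_mul h2 (by linarith) (by positivity) (by linarith)
    have h7 : (6 : ℝ) ≤ 12 * (nnz B * (s * Real.log (2 / δ))) := by nlinarith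
    refine h5.trans ?_
    nlinarith

/-! ## Cost and correctness of GenELinK -/

/-- As `1 ≤ k ≤ d`, the terms `dk`, `k²` and `k³` are all at most `dk²`. The extra unit in `T + 1`
pays for the initialization. -/
theorem genELinK_time_le {d k : ℕ} (hk : 0 < k) (hkd : k ≤ d) (A B : Matrix (Fin d) (Fin d) ℝ)
    (solve : ℝ → Matrix (Fin d) (Fin k) ℝ → Matrix (Fin d) (Fin k) ℝ →
      Timed (Matrix (Fin d) (Fin k) ℝ)) (δ : ℕ → ℝ) (T : ℕ) (X : Matrix (Fin d) (Fin k) ℝ)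
    {c : ℕ → ℝ} (hc : ∀ t < T, ∀ C X₀, ((solve (δ t) C X₀).time : ℝ) ≤ c t) :
    ((genELinK A B solve δ T X).time : ℝ) ≤
      40 * (nnz A * k + nnz B * k + d * k ^ 2) * (T + 1) + ∑ t ∈ Finset.range T, c t := by
  have hd : 0 < d := hk.trans_le hkd
  set n : ℝ := nnz A * k + nnz B * k + d * k ^ 2 with hn
  have hA0 : (0 : ℝ) ≤ nnz A * k := by positivity
  have hB0 : (0 : ℝ) ≤ nnz B * k := by positivity
  have hn0 : (0 : ℝ) ≤ d * k ^ 2 := by positivity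
  have hk1 : (1 : ℝ) ≤ k := by exact_mod_cast hk
  have hkd' : (k : ℝ) ≤ d := by exact_mod_cast hkd
  have hdk : (d : ℝ) * k ≤ d * k ^ 2 := 
    mul_le_mul_of_nonneg_left (le_self_pow₀ hk1 two_ne_zero) (Nat.cast_nonneg d)
  have hkk : (k : ℝ) ^ 2 ≤ d * k ^ 2 := le_mul_of_one_le_left (sq_nonneg _) (hk1.trans hkd')
  have hkkk : (k : ℝ) ^ 3 ≤ d * k ^ 2 := by
    rw [pow_succ']
    exact mul_le_mul_of_nonneg_right hkd' (sq_nonneg _)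
  have hgs : ∀ Y : Matrix (Fin d) (Fin k) ℝ, ((gramSchmidt B Y).time : ℝ) ≤
      4 * (nnz B * k) + 16 * (d * k ^ 2) := fun Y => by
    have : ((gramSchmidt B Y).time : ℝ) ≤ k * (4 * nnz B + 16 * (d * k)) := by
      exact_mod_cast gramSchmidt_time_le hk hd B Y
    linarith
  have hgj : ∀ G H : Matrix (Fin k) (Fin k) ℝ, ((gaussJordan G H).time : ℝ) ≤
      10 * (d * k ^ 2) := fun G H => by
    have : ((gaussJordan G H).time : ℝ) ≤ k * (5 * (k * k) + 5 * (k * k)) := by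
      exact_mod_cast gaussJordan_time_le G H
    linarith
  unfold genELinK
  simp only [bind_time, tick_time, Nat.cast_add, Nat.cast_mul]
  have hloop := loop_time_le (n := T) (c := fun t => 39 * n + c t)
    (body := fun t W => do
      let BW ← sparseMul B W
      let AW ← sparseMul A W
      let G ← denseMul Wᵀ BW
      let H ← denseMul Wᵀ AW
      let Γ ← gaussJordan G H
      let X₀ ← denseMul W Γ
      let Wtilde ← solve (δ t) AW X₀
      gramSchmidt B Wtilde) (fun t ht W => by
    simp only [bind_time, sparseMul_time, denseMul_time, Nat.cast_add, Nat.cast_mul,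
      Nat.cast_ofNat, Nat.cast_one]
    refine (add_le_add_right (add_le_add_right (add_le_add_right (add_le_add_right
      (add_le_add (hgj _ _) (add_le_add_right (add_le_add (hc t ht _ _) (hgs _)) _)) _) _) _)
      _).trans ?_
    linarith) (gramSchmidt B X).val
  rw [Finset.sum_add_distrib, Finset.sum_const, Finset.card_range, nsmul_eq_mul] at hloop
  have hg := hgs X
  have hT : (0 : ℝ) ≤ T * n := by positivity
  linarith

theorem genELinK_achievesError {d k : ℕ} (hk : 0 < k) (hkd : k ≤ d)
    {A B : Matrix (Fin d) (Fin d) ℝ} (hA : A.IsSymm) (hB : B.PosDef) {lam : Fin d → ℝ}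
    {v : Fin d → Fin d → ℝ} (hv : IsGeneralizedEigensystem A B lam v)
    {solve : ℝ → Matrix (Fin d) (Fin k) ℝ → Matrix (Fin d) (Fin k) ℝ →
      Timed (Matrix (Fin d) (Fin k) ℝ)} {σ : ℝ → ℝ} (hsolve : IsBlockSolver B solve σ)
    {ℓ ρ γ ε θ : ℝ} {X : Matrix (Fin d) (Fin k) ℝ}
    (hℓ : 0 < ℓ) (hρ0 : 0 < ρ) (hρ1 : ρ ≤ 1) (hγ : 1 ≤ γ) (hL : ∀ i, |lam i| ≤ γ * ℓ)
    (htop : ∀ i : Fin d, i.val < k → ℓ ≤ |lam i|)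
    (hbot : ∀ i : Fin d, ¬ i.val < k → |lam i| ≤ (1 - ρ) * ℓ)
    (hθ : θ = angle B (gramSchmidt B X).val (topMatrix hkd v)) (hcos : 0 < Real.cos θ)
    (hε0 : 0 < ε) :
    AchievesError B (topMatrix hkd v) ε
      (genELinK A B solve (accuracy k ρ γ θ) (numIter ρ θ ε) X).val := by
  have hBt : Bᵀ = B := by simpa [Matrix.IsHermitian] using hB.isHermitian
  have hθ0 : 0 ≤ θ := hθ ▸ Real.arccos_nonneg _
  have hθπ : θ ≤ Real.pi := hθ ▸ Real.arccos_le_pi _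
  have hsin0 : 0 ≤ Real.sin θ := Real.sin_nonneg_of_nonneg_of_le_pi hθ0 hθπ
  have htan0 : 0 ≤ Real.tan θ := by rw [Real.tan_eq_sin_div_cos]; positivity
  have hcos1 := Real.cos_le_one θ
  have hk1 : (1 : ℝ) ≤ k := by exact_mod_cast hk
  have hden : 64 ≤ 64 * (k : ℝ) * γ ^ 2 := by
    have := one_le_mul_of_one_le_of_one_le hk1 (one_le_pow₀ hγ : 1 ≤ γ ^ 2)
    linarith
  have hr0 : 0 ≤ 1 - ρ / 2 := by linarith
  have hpow : ∀ n : ℕ, (1 - ρ / 2) ^ n ≤ Real.exp (-(ρ / 2 * n)) := fun n => by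
    calc (1 - ρ / 2) ^ n ≤ Real.exp (-(ρ / 2)) ^ n :=
          pow_le_pow_left₀ hr0 (by linarith [Real.add_one_le_exp (-(ρ / 2))]) n
      _ = _ := by rw [← Real.exp_nat_mul]; congr 1; ring
  have hfin : TangentLE B v ((1 - ρ / 2) ^ numIter ρ θ ε * Real.tan θ)
      (genELinK A B solve (accuracy k ρ γ θ) (numIter ρ θ ε) X).val := by
    unfold genELinK
    simp only [bind_val]
    refine loop_invariant (fun t W => TangentLE B v ((1 - ρ / 2) ^ t * Real.tan θ) W) ?_
      fun t _ W hW => ?_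
    · rw [pow_zero, one_mul, hθ]
      exact tangentLE_gramSchmidt hkd hB hv X (hθ ▸ hcos)
    · simp only [bind_val, sparseMul_val, denseMul_val]
      have hG : Wᵀ * (B * W) = 1 := by rw [← Matrix.mul_assoc]; exact hW.orthonormal
      rw [hG, gaussJordan_one_val, pow_succ', mul_assoc]
      have hτ : 0 ≤ (1 - ρ / 2) ^ t * Real.tan θ := by positivity
      -- Both accuracies have this form: `s = cos² θ` in the initial phase, where `cos² θ tan θ =
      -- cos θ sin θ ≤ 1`, and `s = 1` once the tangent is at most one.
      have hstep : ∀ s δ, 0 < s → s ≤ 1 → s * ((1 - ρ / 2) ^ t * Real.tan θ) ≤ 1 →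
          δ = (ρ * s) ^ 2 / (64 * k * γ ^ 2) →
          TangentLE B v ((1 - ρ / 2) * ((1 - ρ / 2) ^ t * Real.tan θ))
            (gramSchmidt B (solve δ (A * W) (W * (Wᵀ * (A * W)))).val).val := by
        intro s δ hs0 hs1 hsτ hδ
        have hρs : (ρ * s) ^ 2 ≤ 1 :=
          pow_le_one₀ (by positivity) (mul_le_one₀ hρ1 hs0.le hs1)
        have hδ0 : 0 < δ := by rw [hδ]; positivity
        have hδ1 : δ < 1 := by rw [hδ, div_lt_one (by linarith)]; linarith
        refine hW.step hkd hA hB hv hτ hℓ hρ0 hρ1 hL htop hbot hs0.le hs1 hsτ hδ0.le ?_ _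
          (hsolve δ hδ0 hδ1 _ _).1
        rw [hδ, mul_div_cancel₀]
        linarith
      unfold accuracy
      split_ifs with ht
      · refine hstep (Real.cos θ ^ 2) _ (by positivity) (pow_le_one₀ hcos.le hcos1) ?_
          (by rw [accuracyInit]; ring)
        calc Real.cos θ ^ 2 * ((1 - ρ / 2) ^ t * Real.tan θ)
            ≤ Real.cos θ ^ 2 * (1 * Real.tan θ) := by
              gcongr
              exact pow_le_one₀ hr0 (by linarith)
          _ = Real.cos θ * Real.sin θ := by
              rw [Real.tan_eq_sin_div_cos]; field_simp
          _ ≤ 1 := mul_le_one₀ hcos1 hsin0 (Real.sin_le_one θ)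
      · refine hstep 1 _ one_pos le_rfl ?_ (by rw [accuracyMain]; ring)
        rw [one_mul]
        rcases htan0.eq_or_lt with h0 | h0
        · rw [← h0, mul_zero]; exact zero_le_one
        have h1 : 2 / ρ * Real.log (Real.tan θ) ≤ t :=
          (Nat.le_ceil _).trans (by exact_mod_cast not_lt.1 ht)
        have h2 : Real.log (Real.tan θ) ≤ ρ / 2 * t := by
          rw [div_mul_eq_mul_div, div_le_iff₀ hρ0] at h1
          linarith
        have h3 : Real.tan θ ≤ Real.exp (ρ / 2 * t) := (Real.log_le_iff_le_exp h0).1 h2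
        calc (1 - ρ / 2) ^ t * Real.tan θ
            ≤ Real.exp (-(ρ / 2 * t)) * Real.exp (ρ / 2 * t) :=
              mul_le_mul (hpow t) h3 htan0 (Real.exp_pos _).le
          _ = 1 := by rw [← Real.exp_add, neg_add_cancel, Real.exp_zero]
  obtain ⟨h1, h2⟩ := hfin.achievesError hk hkd hBt hv (by positivity)
  refine ⟨h1, h2.trans ?_⟩
  have h3 : 2 / ρ * Real.log (1 / (ε * Real.cos θ)) ≤ numIter ρ θ ε := Nat.le_ceil _
  have h4 : Real.log (1 / (ε * Real.cos θ)) ≤ ρ / 2 * numIter ρ θ ε := by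
    rw [div_mul_eq_mul_div, div_le_iff₀ hρ0] at h3
    linarith
  have h5 : (1 - ρ / 2) ^ numIter ρ θ ε ≤ ε * Real.cos θ := by
    refine (hpow _).trans ((Real.exp_le_exp.2 (neg_le_neg h4)).trans_eq ?_)
    rw [Real.exp_neg, Real.exp_log (by positivity), one_div, inv_inv]
  calc (1 - ρ / 2) ^ numIter ρ θ ε * Real.tan θ ≤ ε * Real.cos θ * Real.tan θ :=
        mul_le_mul_of_nonneg_right h5 htan0
    _ = ε * Real.sin θ := by rw [mul_assoc, mul_comm (Real.cos θ), Real.tan_mul_cos hcos.ne']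
    _ ≤ ε := mul_le_of_le_one_right hε0.le (Real.sin_le_one θ)

theorem matNormSqB_eq_sum_normSqB {d k : ℕ} (B : Matrix (Fin d) (Fin d) ℝ)
    (U : Matrix (Fin d) (Fin k) ℝ) : matNormSqB B U = ∑ j, normSqB B (U.col j) :=
  Finset.sum_congr (s₂ := Finset.univ) rfl fun j _ => transpose_mul_mul_apply B U U j j

/-- The squared error is a sum over columns, so the same factor `δ` works; the `+ 1` is the charge
of `columns` per column. -/
theorem IsSolver.columnwise {d k : ℕ} {B : Matrix (Fin d) (Fin d) ℝ}
    {solve : ℝ → (Fin d → ℝ) → (Fin d → ℝ) → Timed (Fin d → ℝ)} {τ : ℝ → ℝ}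
    (h : IsSolver B solve τ) :
    IsBlockSolver (k := k) B (columnwise solve) fun δ => k * (τ δ + 1) := by
  intro δ hδ0 hδ1 C X₀
  constructor
  · rw [matNormSqB_eq_sum_normSqB, matNormSqB_eq_sum_normSqB, Finset.mul_sum]
    exact Finset.sum_le_sum fun j _ => (h δ hδ0 hδ1 (C.col j) (X₀.col j)).1
  · rw [GenEig.columnwise, columns_time]
    push_cast
    calc _ ≤ ∑ _j : Fin k, (τ δ + 1) :=
          Finset.sum_le_sum fun j _ => add_le_add_left (h δ hδ0 hδ1 _ _).2 1
      _ = k * (τ δ + 1) := by simp; ring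

/-! ## Iteration counts -/

section Counts

variable {ρ θ ε : ℝ}

theorem log_inv_cos_le (hcos : 0 < Real.cos θ) (hsin : 0 ≤ Real.sin θ) (h : Real.tan θ ≤ 1) :
    Real.log (1 / Real.cos θ) ≤ Real.log 2 / 2 := by
  rw [Real.tan_eq_sin_div_cos, div_le_one hcos] at h
  have h1 := Real.sin_sq_add_cos_sq θ
  have h2 : Real.log (1 / 2) ≤ Real.log (Real.cos θ ^ 2) :=
    Real.log_le_log (by norm_num) (by nlinarith)
  rw [Real.log_pow, one_div, Real.log_inv] at h2
  rw [one_div, Real.log_inv]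
  push_cast at h2
  linarith

theorem log_tan_bounds (hcos : 0 < Real.cos θ) (h : 1 < Real.tan θ) :
    Real.log 2 / 2 ≤ Real.log (1 / Real.cos θ) ∧
    Real.log (Real.tan θ) ≤ Real.log (1 / Real.cos θ) ∧
    Real.log (1 / Real.cos θ) - Real.log 2 / 2 ≤ Real.log (Real.tan θ) := by
  rw [Real.tan_eq_sin_div_cos, one_lt_div hcos] at h
  have hsin : 0 < Real.sin θ := hcos.trans h
  have h1 := Real.sin_sq_add_cos_sq θ
  have h2 : Real.log (Real.cos θ ^ 2) ≤ Real.log (1 / 2) :=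
    Real.log_le_log (by positivity) (by nlinarith)
  have h3 : Real.log (1 / 2) ≤ Real.log (Real.sin θ ^ 2) :=
    Real.log_le_log (by norm_num) (by nlinarith)
  have h4 : Real.log (Real.sin θ) ≤ 0 := Real.log_nonpos hsin.le (Real.sin_le_one θ)
  rw [Real.log_pow, one_div, Real.log_inv] at h2 h3
  push_cast at h2 h3
  rw [one_div, Real.log_inv, Real.tan_eq_sin_div_cos, Real.log_div hsin.ne' hcos.ne']
  refine ⟨?_, ?_, ?_⟩ <;> linarith

theorem log_inv_cos_nonneg (hcos : 0 < Real.cos θ) : 0 ≤ Real.log (1 / Real.cos θ) :=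
  Real.log_nonneg ((one_le_div hcos).2 (Real.cos_le_one θ))

theorem log_two_le_log_two_div (hε0 : 0 < ε) (hε1 : ε < 1) : Real.log 2 ≤ Real.log (2 / ε) :=
  Real.log_le_log two_pos (by rw [le_div_iff₀ hε0]; linarith)

theorem log_two_div_mul_cos (hcos : 0 < Real.cos θ) (hε0 : 0 < ε) :
    Real.log (2 / (ε * Real.cos θ)) = Real.log (2 / ε) + Real.log (1 / Real.cos θ) := by
  rw [← Real.log_mul (by positivity) (by positivity)]
  congr 1
  field_simp

theorem numIter_lt (hρ0 : 0 < ρ) (hcos : 0 < Real.cos θ) (hε0 : 0 < ε) (hε1 : ε < 1) :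
    (numIter ρ θ ε : ℝ) <
      2 / ρ * (Real.log (2 / ε) - Real.log 2 + Real.log (1 / Real.cos θ)) + 1 := by
  have h1 : Real.log (1 / (ε * Real.cos θ)) =
      Real.log (2 / ε) - Real.log 2 + Real.log (1 / Real.cos θ) := by
    rw [Real.log_div two_ne_zero hε0.ne', one_div, one_div, Real.log_inv, Real.log_inv,
      Real.log_mul hε0.ne' hcos.ne']
    ring
  rw [← h1]
  refine Nat.ceil_lt_add_one (mul_nonneg (by positivity) ?_)
  rw [h1]
  linarith [log_two_le_log_two_div hε0 hε1, log_inv_cos_nonneg hcos]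

/-- No additive constant is needed: the phase is empty unless `tan θ > 1`, and then `log (1 / cos θ)
≥ (log 2) / 2` absorbs the rounding. -/
theorem initIter_le (hρ0 : 0 < ρ) (hρ1 : ρ ≤ 1) (hcos : 0 < Real.cos θ) (hsin : 0 ≤ Real.sin θ) :
    (⌈2 / ρ * Real.log (Real.tan θ)⌉₊ : ℝ) ≤ 5 * (1 / ρ * Real.log (1 / Real.cos θ)) := by
  have h2ρ : 0 < 2 / ρ := by positivity
  have hρ' : 1 ≤ 1 / ρ := (one_le_div hρ0).2 hρ1
  rcases le_or_gt (Real.tan θ) 1 with h | h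
  · have h0 : 0 ≤ Real.tan θ := by rw [Real.tan_eq_sin_div_cos]; positivity
    rw [Nat.ceil_eq_zero.2 (mul_nonpos_of_nonneg_of_nonpos h2ρ.le (Real.log_nonpos h0 h))]
    have := log_inv_cos_nonneg hcos
    rw [Nat.cast_zero]
    positivity
  · obtain ⟨h1, h2, -⟩ := log_tan_bounds hcos h
    have hlog2 := Real.log_two_gt_d9
    have h3 := Nat.ceil_lt_add_one (mul_nonneg h2ρ.le (Real.log_nonneg h.le))
    have h4 := mul_le_mul_of_nonneg_left h2 h2ρ.le
    have h5 : 1 ≤ 3 * (1 / ρ * Real.log (1 / Real.cos θ)) := by nlinarith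
    have h6 : 2 / ρ * Real.log (1 / Real.cos θ) = 2 * (1 / ρ * Real.log (1 / Real.cos θ)) := by
      ring
    linarith

/-- For `tan θ > 1`, `log (1 / cos θ)` and `log (tan θ)` differ by at most `(log 2) / 2`, so the
dependence on `θ` cancels; otherwise `log (1 / cos θ)` itself is that small. -/
theorem mainIter_le (hρ0 : 0 < ρ) (hρ1 : ρ ≤ 1) (hcos : 0 < Real.cos θ) (hsin : 0 ≤ Real.sin θ)
    (hε0 : 0 < ε) (hε1 : ε < 1) :
    (numIter ρ θ ε : ℝ) - ⌈2 / ρ * Real.log (Real.tan θ)⌉₊ ≤ 4 * (1 / ρ * Real.log (2 / ε)) := by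
  have hT := numIter_lt hρ0 hcos hε0 hε1
  have h2ρ : 0 < 2 / ρ := by positivity
  have hρ' : 1 ≤ 1 / ρ := (one_le_div hρ0).2 hρ1
  have he := log_two_le_log_two_div hε0 hε1
  have hlog2 := Real.log_two_gt_d9
  have h1 : 1 ≤ 2 * (1 / ρ * Real.log (2 / ε)) := by nlinarith
  have h2 : 2 / ρ * Real.log (2 / ε) = 2 * (1 / ρ * Real.log (2 / ε)) := by ring
  have h3 : 0 ≤ 2 / ρ * (Real.log 2 / 2) := by positivity
  rcases le_or_gt (Real.tan θ) 1 with h | h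
  · have h4 := mul_le_mul_of_nonneg_left (log_inv_cos_le hcos hsin h) h2ρ.le
    have h5 : (0 : ℝ) ≤ ⌈2 / ρ * Real.log (Real.tan θ)⌉₊ := Nat.cast_nonneg _
    linarith
  · have h4 := mul_le_mul_of_nonneg_left (log_tan_bounds hcos h).2.2 h2ρ.le
    have h5 := Nat.le_ceil (2 / ρ * Real.log (Real.tan θ))
    linarith

theorem numIter_add_one_le (hρ0 : 0 < ρ) (hρ1 : ρ ≤ 1) (hcos : 0 < Real.cos θ)
    (hε0 : 0 < ε) (hε1 : ε < 1) :
    (numIter ρ θ ε : ℝ) + 1 ≤ 6 * (1 / ρ * Real.log (2 / (ε * Real.cos θ))) := by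
  have hT := numIter_lt hρ0 hcos hε0 hε1
  have hρ' : 1 ≤ 1 / ρ := (one_le_div hρ0).2 hρ1
  have he := log_two_le_log_two_div hε0 hε1
  have hc := log_inv_cos_nonneg hcos
  have hlog2 := Real.log_two_gt_d9
  rw [log_two_div_mul_cos hcos hε0]
  have h1 : 1 ≤ 2 * (1 / ρ * (Real.log (2 / ε) + Real.log (1 / Real.cos θ))) := by nlinarith
  have h2 : 0 ≤ 2 / ρ * Real.log 2 := by positivity
  have h3 : 2 / ρ * (Real.log (2 / ε) - Real.log 2 + Real.log (1 / Real.cos θ)) =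
    2 * (1 / ρ * (Real.log (2 / ε) + Real.log (1 / Real.cos θ))) - 2 / ρ * Real.log 2 := by ring
  linarith

end Counts

/-! ### Total running time -/

theorem sum_accuracy_le {k : ℕ} {ρ γ θ : ℝ} (T : ℕ) {σ : ℝ → ℝ} {a b : ℝ}
    (h₁ : 0 ≤ σ (accuracyInit k ρ γ θ)) (h₂ : 0 ≤ σ (accuracyMain k ρ γ)) (hb0 : 0 ≤ b)
    (ha : (⌈2 / ρ * Real.log (Real.tan θ)⌉₊ : ℝ) ≤ a)
    (hb : (T : ℝ) - ⌈2 / ρ * Real.log (Real.tan θ)⌉₊ ≤ b) :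
    ∑ t ∈ Finset.range T, σ (accuracy k ρ γ θ t) ≤
      a * σ (accuracyInit k ρ γ θ) + b * σ (accuracyMain k ρ γ) := by
  set m := ⌈2 / ρ * Real.log (Real.tan θ)⌉₊ with hm
  have key : ∀ T : ℕ, ∑ t ∈ Finset.range T, σ (accuracy k ρ γ θ t) ≤
      m * σ (accuracyInit k ρ γ θ) + ((T - m : ℕ) : ℝ) * σ (accuracyMain k ρ γ) := by
    intro T
    rcases le_total T m with h | h
    · have : ∑ t ∈ Finset.range T, σ (accuracy k ρ γ θ t) = T * σ (accuracyInit k ρ γ θ) := by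
        rw [Finset.sum_congr rfl fun t ht => by
          rw [accuracy, if_pos ((Finset.mem_range.1 ht).trans_le h)]]
        simp
      rw [this, Nat.sub_eq_zero_of_le h, Nat.cast_zero, zero_mul, add_zero]
      gcongr
    · rw [← Finset.sum_range_add_sum_Ico _ h]
      refine (add_le_add (b := m * σ (accuracyInit k ρ γ θ))
        (d := ((T - m : ℕ) : ℝ) * σ (accuracyMain k ρ γ)) (le_of_eq ?_) (le_of_eq ?_))
      · rw [Finset.sum_congr rfl fun t ht => by
          rw [accuracy, if_pos (Finset.mem_range.1 ht)]]
        simp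
      · rw [Finset.sum_congr rfl fun t ht => by
          rw [accuracy, if_neg (not_lt.2 (Finset.mem_Ico.1 ht).1)]]
        simp
  refine (key T).trans (add_le_add (mul_le_mul_of_nonneg_right ha h₁)
    (mul_le_mul_of_nonneg_right ?_ h₂))
  rcases le_total T m with h | h
  · rw [Nat.sub_eq_zero_of_le h, Nat.cast_zero]
    exact hb0
  · rw [Nat.cast_sub h]
    exact hb

theorem accuracy_bounds {k : ℕ} {ρ γ θ : ℝ} (hk : 0 < k) (hρ0 : 0 < ρ) (hρ1 : ρ ≤ 1) (hγ : 1 ≤ γ)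
    (hcos : 0 < Real.cos θ) :
    (0 < accuracyInit k ρ γ θ ∧ accuracyInit k ρ γ θ < 1) ∧
      0 < accuracyMain k ρ γ ∧ accuracyMain k ρ γ < 1 := by
  have hk1 : (1 : ℝ) ≤ k := by exact_mod_cast hk
  have hden : 64 ≤ 64 * (k : ℝ) * γ ^ 2 := by
    have := one_le_mul_of_one_le_of_one_le hk1 (one_le_pow₀ hγ : 1 ≤ γ ^ 2)
    linarith
  have hρ2 : ρ ^ 2 ≤ 1 := pow_le_one₀ hρ0.le hρ1
  have hc4 : Real.cos θ ^ 4 ≤ 1 := pow_le_one₀ hcos.le (Real.cos_le_one θ)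
  have hρc : ρ ^ 2 * Real.cos θ ^ 4 ≤ 1 := mul_le_one₀ hρ2 (by positivity) hc4
  have hγ0 : 0 < γ := by linarith
  refine ⟨⟨by unfold accuracyInit; positivity, ?_⟩, by unfold accuracyMain; positivity, ?_⟩
  · rw [accuracyInit, div_lt_one (by linarith)]; linarith
  · rw [accuracyMain, div_lt_one (by linarith)]; linarith

theorem genELinK_time_le_of_isBlockSolver {d k : ℕ} (hk : 0 < k) (hkd : k ≤ d)
    (A : Matrix (Fin d) (Fin d) ℝ) {B : Matrix (Fin d) (Fin d) ℝ}
    {solve : ℝ → Matrix (Fin d) (Fin k) ℝ → Matrix (Fin d) (Fin k) ℝ →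
      Timed (Matrix (Fin d) (Fin k) ℝ)} {σ : ℝ → ℝ} (hsolve : IsBlockSolver B solve σ)
    {ρ γ ε θ : ℝ} (X : Matrix (Fin d) (Fin k) ℝ) (hρ0 : 0 < ρ) (hρ1 : ρ ≤ 1) (hγ : 1 ≤ γ)
    (hcos : 0 < Real.cos θ) (hsin : 0 ≤ Real.sin θ) (hε0 : 0 < ε) (hε1 : ε < 1) :
    ((genELinK A B solve (accuracy k ρ γ θ) (numIter ρ θ ε) X).time : ℝ) ≤
      240 * (1 / ρ * (Real.log (1 / Real.cos θ) * σ (accuracyInit k ρ γ θ) +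
          σ (accuracyMain k ρ γ) * Real.log (2 / ε)) +
        1 / ρ * (nnz A * k + nnz B * k + d * k ^ 2) * Real.log (2 / (ε * Real.cos θ))) ∧
    0 ≤ σ (accuracyInit k ρ γ θ) ∧ 0 ≤ σ (accuracyMain k ρ γ) := by
  obtain ⟨⟨hi0, hi1⟩, hm0, hm1⟩ := accuracy_bounds hk hρ0 hρ1 hγ hcos
  -- The cost bound has no assumed sign; it dominates the step count of an actual run, here on the
  -- zero system.
  have hσi : 0 ≤ σ (accuracyInit k ρ γ θ) :=
    (Nat.cast_nonneg _).trans (hsolve _ hi0 hi1 0 0).2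
  have hσm : 0 ≤ σ (accuracyMain k ρ γ) :=
    (Nat.cast_nonneg _).trans (hsolve _ hm0 hm1 0 0).2
  refine ⟨?_, hσi, hσm⟩
  have hlog2 := Real.log_two_gt_d9
  have he : 0 ≤ Real.log (2 / ε) := by linarith [log_two_le_log_two_div hε0 hε1]
  have hc := log_inv_cos_nonneg hcos
  have h1 := genELinK_time_le hk hkd A B solve (accuracy k ρ γ θ) (numIter ρ θ ε) X
    (c := fun t => σ (accuracy k ρ γ θ t)) fun t _ C X₀ => by
      unfold accuracy
      split_ifs
      · exact (hsolve _ hi0 hi1 C X₀).2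
      · exact (hsolve _ hm0 hm1 C X₀).2
  have h2 := sum_accuracy_le (numIter ρ θ ε) hσi hσm (by positivity)
    (initIter_le hρ0 hρ1 hcos hsin) (mainIter_le hρ0 hρ1 hcos hsin hε0 hε1)
  have h3 := numIter_add_one_le hρ0 hρ1 hcos hε0 hε1
  set n : ℝ := nnz A * k + nnz B * k + d * k ^ 2 with hn
  have hn0 : 0 ≤ n := by positivity
  have h4 := mul_le_mul_of_nonneg_left h3 (by positivity : 0 ≤ 40 * n)
  have h5 : 0 ≤ 1 / ρ * Real.log (1 / Real.cos θ) * σ (accuracyInit k ρ γ θ) := by positivity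
  have h6 : 0 ≤ 1 / ρ * Real.log (2 / ε) * σ (accuracyMain k ρ γ) := by positivity
  linarith

/-- `2 / δ` is `2⁷ k γ² / (ρ² cos⁴ θ)`; a spare factor `k ≥ 1` completes the square of `kγ / ρ`. -/
theorem log_accuracyInit_le {k : ℕ} {ρ γ θ : ℝ} (hk : 0 < k) (hρ0 : 0 < ρ) (hγ : 1 ≤ γ)
    (hcos : 0 < Real.cos θ) :
    Real.log (2 / accuracyInit k ρ γ θ) ≤
      7 * Real.log 2 + 2 * Real.log (k * γ / ρ) + 4 * Real.log (1 / Real.cos θ) := by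
  have hk1 : (1 : ℝ) ≤ k := by exact_mod_cast hk
  have hγ0 : 0 < γ := by linarith
  have h : 2 / accuracyInit k ρ γ θ ≤
      2 ^ 7 * (k * γ / ρ) ^ 2 * (1 / Real.cos θ) ^ 4 := by
    have : 2 ^ 7 * (k * γ / ρ) ^ 2 * (1 / Real.cos θ) ^ 4 = k * (2 / accuracyInit k ρ γ θ) := by
      unfold accuracyInit
      field_simp
      ring
    rw [this]
    exact le_mul_of_one_le_left (by unfold accuracyInit; positivity) hk1
  refine (Real.log_le_log (by unfold accuracyInit; positivity) h).trans_eq ?_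
  rw [Real.log_mul (by positivity) (by positivity), Real.log_mul (by positivity) (by positivity),
    Real.log_pow, Real.log_pow, Real.log_pow]
  push_cast
  ring

theorem log_accuracyMain_le {k : ℕ} {ρ γ : ℝ} (hk : 0 < k) (hρ0 : 0 < ρ) (hγ : 1 ≤ γ) :
    Real.log (2 / accuracyMain k ρ γ) ≤ 7 * Real.log 2 + 2 * Real.log (k * γ / ρ) := by
  -- The two accuracies agree when `cos θ = 1`.
  have h := log_accuracyInit_le (θ := 0) hk hρ0 hγ (by simp)
  simpa [accuracyInit, accuracyMain] using h

/-- Used with `S = √κ`, `c = log (1 / cos θ₀)`, `e = log (2 / ε)`, `g = log (kγ / ρ)`, `l = log 2`.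
The target has no term `c l`; it is recovered from `c ≤ c² + 1/4 ≤ c² + e l`. The constant is `813 =
45 · 11 + 45 · 7 + 3`. -/
theorem agd_cost_le {a b m k S ρ c e g l i₁ i₂ : ℝ} (ha : 0 ≤ a) (hb : 0 ≤ b) (hm : 0 ≤ m)
    (hk : 0 ≤ k) (hS : 1 ≤ S) (hρ : 0 < ρ) (hc : 0 ≤ c) (hg : 0 ≤ g) (hl : 1 / 2 ≤ l) (hl1 : l ≤ 1)
    (hle : l ≤ e) (h₁ : i₁ ≤ 7 * l + 2 * g + 4 * c) (h₂ : i₂ ≤ 7 * l + 2 * g) :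
    1 / ρ * (c * (k * (45 * (b * (S * i₁)))) + k * (45 * (b * (S * i₂))) * e) +
      1 / ρ * (a * k + b * k + m) * (e + c) ≤
    813 * (b * k * S / ρ * (c * (g + c) + e * (l + g)) + (a * k + m) / ρ * (e + c)) := by
  have he : 0 ≤ e := by linarith
  set Q := c * (g + c) + e * (l + g) with hQ
  have hel : 1 / 2 * e ≤ e * l := by nlinarith
  have hcg : 0 ≤ c * g := by positivity
  have heg : 0 ≤ e * g := by positivity
  have hcQ : c ≤ Q := by nlinarith [sq_nonneg (c - 1 / 2)]
  have heQ : e ≤ 2 * Q := by nlinarith [sq_nonneg c]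
  have h₁' : c * i₁ ≤ 11 * Q := by
    have := mul_le_mul_of_nonneg_left h₁ hc
    have : c * l ≤ c * 1 := mul_le_mul_of_nonneg_left hl1 hc
    nlinarith [sq_nonneg c]
  have h₂' : e * i₂ ≤ 7 * Q := by
    have := mul_le_mul_of_nonneg_left h₂ he
    nlinarith [sq_nonneg c]
  set M := b * k * S / ρ with hM
  have hM0 : 0 ≤ M := by positivity
  have hbM : b * k / ρ ≤ M := by
    exact div_le_div_of_nonneg_right (le_mul_of_one_le_right (by positivity) hS) hρ.le
  have h3 : M * (c * i₁) ≤ M * (11 * Q) := mul_le_mul_of_nonneg_left h₁' hM0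
  have h4 : M * (e * i₂) ≤ M * (7 * Q) := mul_le_mul_of_nonneg_left h₂' hM0
  have h5 : b * k / ρ * (e + c) ≤ M * (3 * Q) :=
    mul_le_mul hbM (by linarith) (by linarith) hM0
  have h6 : 0 ≤ (a * k + m) / ρ * (e + c) := by positivity
  have h7 : 1 / ρ * (c * (k * (45 * (b * (S * i₁)))) + k * (45 * (b * (S * i₂))) * e) +
      1 / ρ * (a * k + b * k + m) * (e + c) =
      45 * (M * (c * i₁)) + 45 * (M * (e * i₂)) + b * k / ρ * (e + c) +
        (a * k + m) / ρ * (e + c) := by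
    rw [hM]; ring
  rw [h7]
  linarith

end GenEig

/-! ### Assembly of the three bounds -/

theorem theorem4p2 :
    ∃ K : ℝ, 0 < K ∧
      ∀ (d k : ℕ) (hk : 0 < k) (hkd : k < d)
        (A B : Matrix (Fin d) (Fin d) ℝ), A.IsSymm → B.PosDef →
      ∀ (lam : Fin d → ℝ) (v : Fin d → Fin d → ℝ),
        GenEig.IsGeneralizedEigensystem A B lam v →
        |lam ⟨k, hkd⟩| < |lam ⟨k - 1, by omega⟩| →
      ∀ (W₀tilde V : Matrix (Fin d) (Fin k) ℝ) (ρ γ θ₀ ε : ℝ),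
        V = GenEig.topMatrix hkd.le v →
        ρ = 1 - |lam ⟨k, hkd⟩| / |lam ⟨k - 1, by omega⟩| →
        γ = |lam ⟨0, by omega⟩| / |lam ⟨k - 1, by omega⟩| →
        θ₀ = GenEig.angle B (GenEig.gramSchmidt B W₀tilde).val V →
        0 < Real.cos θ₀ → 0 < ε → ε < 1 →
        -- a black-box solver for the `k` systems of one iteration, of cost `τ δ`
        (∀ (solve : ℝ → Matrix (Fin d) (Fin k) ℝ → Matrix (Fin d) (Fin k) ℝ →
              GenEig.Timed (Matrix (Fin d) (Fin k) ℝ)) (τ : ℝ → ℝ),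
          GenEig.IsBlockSolver B solve τ →
          ∀ R : GenEig.Timed (Matrix (Fin d) (Fin k) ℝ),
            R = GenEig.genELinK A B solve (GenEig.accuracy k ρ γ θ₀)
              (GenEig.numIter ρ θ₀ ε) W₀tilde →
            GenEig.AchievesError B V ε R.val ∧
            (R.time : ℝ) ≤ K *
              (1 / ρ * (Real.log (1 / Real.cos θ₀) *
                    τ (ρ ^ 2 * Real.cos θ₀ ^ 4 / (64 * k * γ ^ 2)) +
                  τ (ρ ^ 2 / (64 * k * γ ^ 2)) * Real.log (2 / ε)) +
                1 / ρ * (GenEig.nnz A * k + GenEig.nnz B * k + d * k ^ 2) *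
                  Real.log (2 / (ε * Real.cos θ₀)))) ∧
        -- a black-box solver for single systems, of cost `τ δ`, used column by column
        (∀ (solve : ℝ → (Fin d → ℝ) → (Fin d → ℝ) → GenEig.Timed (Fin d → ℝ)) (τ : ℝ → ℝ),
          GenEig.IsSolver B solve τ →
          ∀ R : GenEig.Timed (Matrix (Fin d) (Fin k) ℝ),
            R = GenEig.genELinK A B (GenEig.columnwise solve) (GenEig.accuracy k ρ γ θ₀)
              (GenEig.numIter ρ θ₀ ε) W₀tilde →
            GenEig.AchievesError B V ε R.val ∧
            (R.time : ℝ) ≤ K *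
              (1 / ρ * (Real.log (1 / Real.cos θ₀) *
                    (k * τ (ρ ^ 2 * Real.cos θ₀ ^ 4 / (64 * k * γ ^ 2))) +
                  k * τ (ρ ^ 2 / (64 * k * γ ^ 2)) * Real.log (2 / ε)) +
                1 / ρ * (GenEig.nnz A * k + GenEig.nnz B * k + d * k ^ 2) *
                  Real.log (2 / (ε * Real.cos θ₀)))) ∧
        -- Nesterov's accelerated gradient descent
        (∀ R : GenEig.Timed (Matrix (Fin d) (Fin k) ℝ),
            R = GenEig.genELinK A B (GenEig.columnwise (GenEig.agdSolver B))
              (GenEig.accuracy k ρ γ θ₀) (GenEig.numIter ρ θ₀ ε) W₀tilde →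
            GenEig.AchievesError B V ε R.val ∧
            (R.time : ℝ) ≤ K *
              (GenEig.nnz B * k * Real.sqrt (GenEig.cond B) / ρ *
                  (Real.log (1 / Real.cos θ₀) * Real.log (k * γ / (ρ * Real.cos θ₀)) +
                    Real.log (2 / ε) * Real.log (2 * k * γ / ρ)) +
                (GenEig.nnz A * k + d * k ^ 2) / ρ *
                  Real.log (2 / (ε * Real.cos θ₀)))) := by
  -- The gradient descent bound is the most demanding one, with `480 · 813 = 390240`.
  refine ⟨400000, by norm_num, ?_⟩
  intro d k hk hkd A B hA hB lam v hv hgap W₀tilde V ρ γ θ₀ ε hV hρ hγ hθ hcos hε0 hε1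
  subst hV
  have hd : 0 < d := by omega
  set ℓ := |lam ⟨k - 1, by omega⟩| with hℓdef
  have hℓ : 0 < ℓ := (abs_nonneg _).trans_lt hgap
  have hρℓ : (1 - ρ) * ℓ = |lam ⟨k, hkd⟩| := by rw [hρ]; field_simp; ring
  have hγℓ : γ * ℓ = |lam ⟨0, by omega⟩| := by rw [hγ]; field_simp
  have hρ0 : 0 < ρ := by rw [hρ, sub_pos, div_lt_one hℓ]; exact hgap
  have hρ1 : ρ ≤ 1 := by
    rw [hρ]
    exact sub_le_self _ (div_nonneg (abs_nonneg _) hℓ.le)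
  have hγ1 : 1 ≤ γ := by
    rw [hγ, one_le_div hℓ]
    exact hv.antitone _ _ (Fin.mk_le_mk.2 (Nat.zero_le _))
  have hL : ∀ i, |lam i| ≤ γ * ℓ := fun i => by
    rw [hγℓ]
    exact hv.antitone _ _ (Fin.mk_le_of_le_val (Nat.zero_le _))
  have htop : ∀ i : Fin d, i.val < k → ℓ ≤ |lam i| := fun i hi =>
    hv.antitone _ _ (Fin.le_def.2 (Nat.le_sub_one_of_lt hi))
  have hbot : ∀ i : Fin d, ¬ i.val < k → |lam i| ≤ (1 - ρ) * ℓ := fun i hi => by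
    rw [hρℓ]
    exact hv.antitone _ _ (Fin.le_def.2 (not_lt.1 hi))
  have hsin : 0 ≤ Real.sin θ₀ := by
    rw [hθ]
    exact Real.sin_nonneg_of_nonneg_of_le_pi (Real.arccos_nonneg _) (Real.arccos_le_pi _)
  have hk1 : (1 : ℝ) ≤ k := by exact_mod_cast hk
  have hd1 : (1 : ℝ) ≤ d := by exact_mod_cast hd
  have hkdk : (k : ℝ) ≤ d * k ^ 2 := by
    calc (k : ℝ) ≤ k ^ 2 := le_self_pow₀ hk1 two_ne_zero
      _ ≤ d * k ^ 2 := le_mul_of_one_le_left (sq_nonneg _) hd1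
  have hlog2 := Real.log_two_gt_d9
  have hle := GenEig.log_two_le_log_two_div hε0 hε1
  have he : 0 ≤ Real.log (2 / ε) := by linarith
  have hc := GenEig.log_inv_cos_nonneg hcos
  have hsum := GenEig.log_two_div_mul_cos hcos hε0
  set e := Real.log (2 / ε) with hedef
  set c := Real.log (1 / Real.cos θ₀) with hcdef
  set n : ℝ := GenEig.nnz A * k + GenEig.nnz B * k + d * k ^ 2 with hn
  have hn0 : 0 ≤ n := by positivity
  -- the cost with a solver for single systems, used column by column
  have hcol : ∀ (solve : ℝ → (Fin d → ℝ) → (Fin d → ℝ) → GenEig.Timed (Fin d → ℝ)) (τ : ℝ → ℝ),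
      GenEig.IsSolver B solve τ →
      ((GenEig.genELinK A B (GenEig.columnwise solve) (GenEig.accuracy k ρ γ θ₀)
        (GenEig.numIter ρ θ₀ ε) W₀tilde).time : ℝ) ≤ 480 *
          (1 / ρ * (c * (k * τ (GenEig.accuracyInit k ρ γ θ₀)) +
            k * τ (GenEig.accuracyMain k ρ γ) * e) + 1 / ρ * n * (e + c)) ∧
      0 ≤ τ (GenEig.accuracyInit k ρ γ θ₀) ∧ 0 ≤ τ (GenEig.accuracyMain k ρ γ) := by
    intro solve τ hsolve
    obtain ⟨⟨hi0, hi1⟩, hm0, hm1⟩ := GenEig.accuracy_bounds hk hρ0 hρ1 hγ1 hcos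
    have hτi := (Nat.cast_nonneg _).trans (hsolve _ hi0 hi1 0 0).2
    have hτm := (Nat.cast_nonneg _).trans (hsolve _ hm0 hm1 0 0).2
    refine ⟨?_, hτi, hτm⟩
    have h := (GenEig.genELinK_time_le_of_isBlockSolver hk hkd.le A hsolve.columnwise W₀tilde
      hρ0 hρ1 hγ1 hcos hsin hε0 hε1).1
    rw [hsum] at h
    -- The per-column charges add `k (e + c) / ρ`, dominated by the linear algebra term; hence `480`
    -- instead of `240`.
    have h1 : 1 / ρ * (k * (e + c)) ≤ 1 / ρ * (n * (e + c)) := by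
      have : (k : ℝ) ≤ n := hkdk.trans (le_add_of_nonneg_left (by positivity))
      gcongr
    have h2 : 0 ≤ 1 / ρ * (c * (k * τ (GenEig.accuracyInit k ρ γ θ₀)) +
        k * τ (GenEig.accuracyMain k ρ γ) * e) := by positivity
    linarith
  refine ⟨?_, ?_, ?_⟩
  · rintro solve τ hsolve R rfl
    refine ⟨GenEig.genELinK_achievesError hk hkd.le hA hB hv hsolve hℓ hρ0 hρ1 hγ1 hL htop hbot hθ
      hcos hε0, ?_⟩
    obtain ⟨h, hτi, hτm⟩ := GenEig.genELinK_time_le_of_isBlockSolver hk hkd.le A hsolve W₀tilde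
      hρ0 hρ1 hγ1 hcos hsin hε0 hε1
    rw [hsum] at h ⊢
    refine h.trans (mul_le_mul_of_nonneg_right (by norm_num) ?_)
    positivity
  · rintro solve τ hsolve R rfl
    refine ⟨GenEig.genELinK_achievesError hk hkd.le hA hB hv hsolve.columnwise hℓ hρ0 hρ1 hγ1 hL
      htop hbot hθ hcos hε0, ?_⟩
    obtain ⟨h, hτi, hτm⟩ := hcol solve τ hsolve
    rw [hsum]
    refine h.trans (mul_le_mul_of_nonneg_right (by norm_num) ?_)
    positivity
  · rintro R rfl
    have hsolve := GenEig.agdSolver_isSolver hd hB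
    refine ⟨GenEig.genELinK_achievesError hk hkd.le hA hB hv hsolve.columnwise hℓ hρ0 hρ1 hγ1 hL
      htop hbot hθ hcos hε0, ?_⟩
    have h := (hcol _ _ hsolve).1
    have hS : 1 ≤ Real.sqrt (GenEig.cond B) := Real.one_le_sqrt.2 (GenEig.one_le_cond hd hB)
    have hγ0 : 0 < γ := by linarith
    have hk0 : (0 : ℝ) < k := by linarith
    have hkγ : 1 ≤ k * γ / ρ :=
      (one_le_div hρ0).2 (hρ1.trans (one_le_mul_of_one_le_of_one_le hk1 hγ1))
    have hg : 0 ≤ Real.log (k * γ / ρ) := Real.log_nonneg hkγ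
    have e₁ : Real.log (k * γ / (ρ * Real.cos θ₀)) = Real.log (k * γ / ρ) + c := by
      rw [hcdef, ← Real.log_mul (by positivity) (by positivity)]
      congr 1
      field_simp
    have e₂ : Real.log (2 * k * γ / ρ) = Real.log 2 + Real.log (k * γ / ρ) := by
      rw [← Real.log_mul (by positivity) (by positivity)]
      congr 1
      ring
    have hcost := GenEig.agd_cost_le (a := GenEig.nnz A) (b := GenEig.nnz B) (m := d * k ^ 2)
      (Nat.cast_nonneg _) (Nat.cast_nonneg _) (by positivity) hk0.le hS hρ0 hc hg
      (by linarith : 1 / 2 ≤ Real.log 2) (by linarith [Real.log_two_lt_d9]) hle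
      (GenEig.log_accuracyInit_le hk hρ0 hγ1 hcos) (GenEig.log_accuracyMain_le hk hρ0 hγ1)
    rw [hsum, e₁, e₂]
    refine (h.trans (mul_le_mul_of_nonneg_left hcost (by norm_num))).trans ?_
    rw [← mul_assoc]
    refine mul_le_mul_of_nonneg_right (by norm_num) ?_
    positivity
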